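/- Let $n\ge 0$ and let $B_n$ be the hyperoctahedral group, i.e. the Coxeter group with simple generators $s_0,\dots,s_{n-1}$ and $m(s_0,s_1)=4$, $m(s_i,s_{i+1})=3$ for $1\le i\le n-2$, $m(s_i,s_j)=2$ for $|i-j|\ge 2$; let $\ell$ be its length function and let $\mathrm{Des}(x)=\{i\in\{0,\dots,n-1\}:\ell(s_ix)<\ell(x)\}$ for $x\in B_n$. Let $H_n^B(0)$ be the $0$-Hecke algebra of $B_n$ over $\mathbb C$, generated by $\pi_0,\dots,\pi_{n-1}$ with relations $\pi_i^2=-\pi_i$ and $\cdots\pi_j\pi_i\pi_j=\cdots\pi_i\pi_j\pi_i$ ($m(s_i,s_j)$ factors on each side) for $i\ne j$. For $I\subseteq\{0,\dots,n-1\}$ let $\mathcal S_I^B$ be the one-dimensional $H_n^B(0)$-module on which $\pi_j$ acts as $-1$ if $j\in I$ and as $0$ otherwise, and let \[F_I^B=\sum_{\substack{0=i_0\le i_1\le\cdots\le i_n\\ j\in I\Rightarrow i_j<i_{j+1}}}x_{i_1}x_{i_2}\cdots x_{i_n}.\] Let $\mathcal G_0(H_n^B(0))$ be the Grothendieck group of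 finitely generated $H_n^B(0)$-modules (generated by isomorphism classes, modulo $[A]-[B]+[C]=0$ for each short exact sequence $0\to A\to B\to C\to 0$), and let $\mathrm{ch}^B$ be the unique homomorphism from it to the power series in $x_0,x_1,\dots$ with $\mathrm{ch}^B([\mathcal S_I^B])=F_I^B$ for all $I$; write $\mathrm{ch}^B(M)=\mathrm{ch}^B([M])$. Let $X\subseteq B_n$ be ascent-compatible: for all $u,v\in X$ and all $i,j$ with $i\notin\mathrm{Des}(u)$, $j\notin\mathrm{Des}(v)$ and $u^{-1}s_iu=v^{-1}s_jv$, one has $s_iu\in X$ if and only if $s_jv\in X$. Then the linear operators on the complex vector space $\mathbb CX$ with basis $X$ given, for $x\in X$, by \[\pi_i(x)=\begin{cases}-x&\text{if } i\in\mathrm{Des}(x),\\ 0&\text{if } i\notin\mathrm{Des}(x)\text{ and }s_ix\notin X,\\ s_ix&\text{if } i\notin\mathrm{Des}(x)\text{ and }s_ix\in X\end{cases}\] define an $H_n^B(0)$-module structure on $\mathbb CX$, and \[\mathrm{ch}^B(\mathbb CX)=\sum_{x\in X}F^B_{\mathrm{Des}(x)}.\] -/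

import Mathlib

namespace TypeB

/-- The relations of the generators `s_0, …, s_{n-1}` of type `B_n` in a monoid, with `s_i² = 1` or
`s_i² = s_i`. This and the facts on chains below serve to show that the hyperoctahedral group is
finite, that its `0`-Hecke algebra is finite-dimensional, and that the simple modules of the latter
are one-dimensional. -/
structure ChainRel {G : Type*} [Monoid G] (s : ℕ → G) (n : ℕ) : Prop where
  sq : ∀ i, i < n → s i * s i = 1 ∨ s i * s i = s i
  comm : ∀ i j, i + 2 ≤ j → j < n → s i * s j = s j * s i
  braid : ∀ i, 1 ≤ i → i + 1 < n → s i * s (i + 1) * s i = s (i + 1) * s i * s (i + 1)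
  four : 1 < n → s 0 * s 1 * s 0 * s 1 = s 1 * s 0 * s 1 * s 0

/-- The minimal coset representatives `1, s_k, s_{k-1} s_k, …, s_0 ⋯ s_k, s_1 s_0 s_1 ⋯ s_k, …` of
`B_{k+1}` modulo `B_k`. -/
def chain {G : Type*} [Monoid G] (s : ℕ → G) (k : ℕ) : ℕ → G
  | 0 => 1
  | j + 1 => s (if j ≤ k then k - j else j - k) * chain s k j

section
variable {G : Type*} [Monoid G] {s : ℕ → G} {n k : ℕ}

theorem chain_succ_of_le {j : ℕ} (h : j ≤ k) : chain s k (j + 1) = s (k - j) * chain s k j := by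
  simp [chain, h]

theorem chain_up (t : ℕ) : chain s k (k + 1 + t + 1) = s (t + 1) * chain s k (k + 1 + t) := by
  rw [chain, if_neg (by omega)]
  congr 2
  omega

theorem chain_comm_low (H : ChainRel s n) (hk : k < n) {i j : ℕ} (h : i + j + 1 ≤ k) :
    s i * chain s k j = chain s k j * s i := by
  induction j with
  | zero => simp [chain]
  | succ j ih =>
    rw [chain_succ_of_le (by omega), ← mul_assoc, H.comm i (k - j) (by omega) (by omega),
      mul_assoc, ih (by omega), mul_assoc]

theorem chain_shift (H : ChainRel s n) (hk : k < n) {m j : ℕ} (hm : 1 ≤ m) (hj : j ≤ k + 1)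
    (h : k + 1 ≤ m + j) (hmk : m + 1 ≤ k) :
    s (m + 1) * chain s k j = chain s k j * s m := by
  induction j with
  | zero => omega
  | succ j ih =>
    rw [chain_succ_of_le (by omega)]
    rcases Nat.lt_or_ge (k - j) m with hlt | hge
    · rw [← mul_assoc, ← H.comm (k - j) (m + 1) (by omega) (by omega), mul_assoc,
        ih (by omega) (by omega), mul_assoc]
    · have hmj : k - j = m := by omega
      obtain ⟨j, rfl⟩ : ∃ j', j = j' + 1 := ⟨j - 1, by omega⟩
      have hm1 : k - j = m + 1 := by omega
      rw [hmj, chain_succ_of_le (by omega), hm1, ← mul_assoc, ← mul_assoc,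
        ← H.braid m hm (by omega), mul_assoc, chain_comm_low H hk (by omega)]
      simp only [mul_assoc]

theorem chain_shift_up (H : ChainRel s n) (hk : k < n) {m t : ℕ} (h : t + 1 ≤ m)
    (hmk : m + 1 ≤ k) :
    s (m + 1) * chain s k (k + 1 + t) = chain s k (k + 1 + t) * s m := by
  induction t with
  | zero => exact chain_shift H hk (by omega) (by omega) (by omega) hmk
  | succ t ih =>
    rw [← add_assoc, chain_up, ← mul_assoc, ← H.comm (t + 1) (m + 1) (by omega) (by omega),
      mul_assoc, ih (by omega), mul_assoc]

theorem chain_comm_up (H : ChainRel s n) (hk : k < n) {i t : ℕ} (h : i < t) (ht : t ≤ k) :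
    s i * chain s k (k + 1 + t) = chain s k (k + 1 + t) * s i := by
  induction t with
  | zero => omega
  | succ t ih =>
    rw [← add_assoc, chain_up]
    rcases Nat.lt_or_ge i t with hlt | hge
    · rw [← mul_assoc, H.comm i (t + 1) (by omega) (by omega), mul_assoc, ih hlt (by omega),
        mul_assoc]
    · obtain rfl : i = t := by omega
      cases i with
      | zero =>
        obtain ⟨k, rfl⟩ : ∃ k', k = k' + 1 := ⟨k - 1, by omega⟩
        have e : chain s (k + 1) (k + 1 + 1 + 0) = s 0 * (s 1 * chain s (k + 1) k) := by
          rw [add_zero, chain_succ_of_le (by omega), chain_succ_of_le (by omega)]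
          simp
        have c := chain_comm_low (s := s) (k := k + 1) H hk (i := 0) (j := k) (by omega)
        have f := congrArg (· * chain s (k + 1) k) (H.four (by omega))
        simp only [mul_assoc, c] at f
        rw [e]
        simpa only [mul_assoc, zero_add] using f
      | succ i =>
        have c := chain_shift_up (s := s) H hk (m := i + 1) (t := i) (by omega) (by omega)
        have f := congrArg (· * chain s k (k + 1 + i)) (H.braid (i + 1) (by omega) (by omega))
        simp only [mul_assoc, c] at f
        rw [← add_assoc, chain_up]
        simpa only [mul_assoc] using f

theorem chain_step (H : ChainRel s n) (hk : k < n) {i j : ℕ} (hi : i ≤ k) (hj : j ≤ 2 * k + 1) :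
    (∃ l, l < k ∧ s i * chain s k j = chain s k j * s l) ∨
    (j < 2 * k + 1 ∧ s i * chain s k j = chain s k (j + 1)) ∨
    (∃ j', j = j' + 1 ∧ chain s k j = s i * chain s k j') := by
  rcases Nat.lt_or_ge k j with hkj | hkj
  · obtain ⟨t, rfl⟩ : ∃ t, j = k + 1 + t := ⟨j - (k + 1), by omega⟩
    rcases lt_trichotomy i t with h | h | h
    · exact Or.inl ⟨i, by omega, chain_comm_up H hk h (by omega)⟩
    · subst h
      refine Or.inr (Or.inr ⟨k + i, by omega, ?_⟩)
      cases i with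
      | zero => rw [add_zero, add_zero, chain_succ_of_le le_rfl, Nat.sub_self]
      | succ i => rw [← add_assoc, chain_up]; congr 2; omega
    · rcases Nat.lt_or_ge (t + 1) i with h' | h'
      · obtain ⟨m, rfl⟩ : ∃ m, i = m + 1 := ⟨i - 1, by omega⟩
        exact Or.inl ⟨m, by omega, chain_shift_up H hk (by omega) hi⟩
      · obtain rfl : i = t + 1 := by omega
        exact Or.inr (Or.inl ⟨by omega, (chain_up t).symm⟩)
  · rcases lt_trichotomy (i + j) k with h | h | h
    · exact Or.inl ⟨i, by omega, chain_comm_low H hk (by omega)⟩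
    · refine Or.inr (Or.inl ⟨by omega, ?_⟩)
      rw [chain_succ_of_le hkj]
      congr 2
      omega
    · rcases Nat.lt_or_ge (k + 1) (i + j) with h' | h'
      · obtain ⟨m, rfl⟩ : ∃ m, i = m + 1 := ⟨i - 1, by omega⟩
        exact Or.inl ⟨m, by omega, chain_shift H hk (by omega) (by omega) (by omega) hi⟩
      · obtain ⟨j, rfl⟩ : ∃ j', j = j' + 1 := ⟨j - 1, by omega⟩
        refine Or.inr (Or.inr ⟨j, rfl, ?_⟩)
        rw [chain_succ_of_le (by omega)]
        congr 2
        omega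

theorem finite_closure (H : ChainRel s n) :
    ∀ k, k ≤ n → (Submonoid.closure (s '' {i | i < k}) : Set G).Finite := by
  intro k
  induction k with
  | zero => intro _; simp
  | succ k ih =>
    intro hk
    set N := Submonoid.closure (s '' {i | i < k}) with hN
    have hfin := ih (by omega)
    refine ((Set.Finite.image2 (fun j x => chain s k j * x)
      (Set.finite_le_nat (2 * k + 1)) hfin).subset ?_)
    intro x hx
    induction hx using Submonoid.closure_induction_left with
    | one => exact ⟨0, by simp, 1, N.one_mem, by simp [chain]⟩
    | mul_left x hx y _ hy =>
      obtain ⟨i, hi, rfl⟩ := hx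
      obtain ⟨j, hj, z, hz, rfl⟩ := hy
      simp only [Set.mem_ofPred_eq] at hi hj
      rcases chain_step H (by omega) (by omega : i ≤ k) hj with ⟨l, hl, e⟩ | ⟨hj', e⟩ | ⟨j', rfl, e⟩
      · refine ⟨j, hj, s l * z, N.mul_mem (Submonoid.subset_closure ⟨l, hl, rfl⟩) hz, ?_⟩
        simp only
        rw [← mul_assoc, ← mul_assoc, e]
      · refine ⟨j + 1, by simp only [Set.mem_ofPred_eq]; omega, z, hz, ?_⟩
        simp only
        rw [← mul_assoc, e]
      · rcases H.sq i (by omega) with h1 | h1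
        · refine ⟨j', by simp only [Set.mem_ofPred_eq]; omega, z, hz, ?_⟩
          simp only
          rw [e, ← mul_assoc, ← mul_assoc, h1, one_mul]
        · refine ⟨j' + 1, hj, z, hz, ?_⟩
          simp only
          rw [e, ← mul_assoc, ← mul_assoc, h1]

end


theorem exists_eigenvector {K V : Type*} [Field K] [AddCommGroup V] [Module K V] [Nontrivial V]
    {n : ℕ} {s : ℕ → Module.End K V} (H : ChainRel s n) (hid : ∀ i, i < n → s i * s i = s i) :
    ∀ k, k ≤ n → ∃ v : V, v ≠ 0 ∧ ∀ i, i < k → ∃ a : K, s i v = a • v := by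
  classical
  intro k
  induction k with
  | zero => intro _; obtain ⟨v, hv⟩ := exists_ne (0 : V); exact ⟨v, hv, by simp⟩
  | succ k ih =>
    intro hk
    obtain ⟨v, hv, hev⟩ := ih (by omega)
    have h0 : (0 : ℕ) ≤ 2 * k + 1 ∧ chain s k 0 v ≠ 0 := ⟨by omega, by simpa [chain] using hv⟩
    set j := Nat.findGreatest (fun j => chain s k j v ≠ 0) (2 * k + 1) with hj
    have hjle : j ≤ 2 * k + 1 := Nat.findGreatest_le _
    have hjv : chain s k j v ≠ 0 :=
      Nat.findGreatest_spec (P := fun j => chain s k j v ≠ 0) h0.1 h0.2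
    refine ⟨chain s k j v, hjv, fun i hi => ?_⟩
    rcases chain_step H (by omega) (by omega : i ≤ k) hjle with ⟨l, hl, e⟩ | ⟨hj', e⟩ | ⟨j', _, e⟩
    · obtain ⟨a, ha⟩ := hev l hl
      refine ⟨a, ?_⟩
      rw [← Module.End.mul_apply, e, Module.End.mul_apply, ha, map_smul]
    · refine ⟨0, ?_⟩
      rw [← Module.End.mul_apply, e, zero_smul]
      by_contra hne
      have := Nat.le_findGreatest (P := fun j => chain s k j v ≠ 0) (n := 2 * k + 1)
        (m := j + 1) (by omega) hne
      omega
    · refine ⟨1, ?_⟩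
      rw [← Module.End.mul_apply, e, ← mul_assoc, hid i (by omega), one_smul]

/-- The Coxeter matrix of type `B_n`, with simple generators `s_0, …, s_{n-1}` indexed by `Fin n`:
`m(s_0, s_1) = 4`, `m(s_i, s_{i+1}) = 3` for `1 ≤ i`, and `m(s_i, s_j) = 2` for `|i - j| ≥ 2`. -/
def matrixB (n : ℕ) : CoxeterMatrix (Fin n) where
  M := Matrix.of fun i j : Fin n ↦
    if i = j then 1
    else if (i : ℕ) + 1 = j ∨ (j : ℕ) + 1 = i then
      (if (i : ℕ) = 0 ∨ (j : ℕ) = 0 then 4 else 3)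
    else 2
  isSymm := by
    ext i j
    simp only [Matrix.transpose_apply, Matrix.of_apply]
    grind
  diagonal := by simp
  off_diagonal := by
    intro i j h
    simp only [Matrix.of_apply]
    grind

theorem matrixB_apply (n : ℕ) (i j : Fin n) : matrixB n i j =
    if i = j then 1
    else if (i : ℕ) + 1 = j ∨ (j : ℕ) + 1 = i then
      (if (i : ℕ) = 0 ∨ (j : ℕ) = 0 then 4 else 3)
    else 2 := rfl

section Hecke

variable {B : Type} (M : CoxeterMatrix B)

/-- The defining relations of the `0`-Hecke algebra: `π_s² = -π_s`, and
`[π_s | π_t]_{m(s,t)} = [π_t | π_s]_{m(s,t)}` for distinct `s, t` with `m(s,t)` finite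
(an infinite `m(s,t)` is encoded by `0`). -/
inductive HeckeRel : FreeAlgebra ℂ B → FreeAlgebra ℂ B → Prop
  | quad (s : B) : HeckeRel (FreeAlgebra.ι ℂ s * FreeAlgebra.ι ℂ s) (-FreeAlgebra.ι ℂ s)
  | braid (s t : B) (hst : s ≠ t) (hm : M s t ≠ 0) :
      HeckeRel
        ((CoxeterSystem.alternatingWord s t (M s t)).map (FreeAlgebra.ι ℂ)).prod
        ((CoxeterSystem.alternatingWord t s (M s t)).map (FreeAlgebra.ι ℂ)).prod

/-- The `0`-Hecke algebra over `ℂ`. -/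
abbrev ZeroHecke : Type := RingQuot (HeckeRel M)

namespace ZeroHecke

/-- The generator `π_s`. -/
def gen (s : B) : ZeroHecke M := RingQuot.mkAlgHom ℂ (HeckeRel M) (FreeAlgebra.ι ℂ s)

variable {M}

theorem gen_sq (s : B) : gen M s * gen M s = -gen M s := by
  have := RingQuot.mkAlgHom_rel ℂ (HeckeRel.quad (M := M) s)
  simpa [gen] using this

theorem gen_braid (s t : B) (hst : s ≠ t) (hm : M s t ≠ 0) :
    ((CoxeterSystem.alternatingWord s t (M s t)).map (gen M)).prod =
      ((CoxeterSystem.alternatingWord t s (M s t)).map (gen M)).prod := by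
  have := RingQuot.mkAlgHom_rel ℂ (HeckeRel.braid (M := M) s t hst hm)
  simp only [map_list_prod, List.map_map] at this
  exact this

/-- Elements of an algebra satisfying the defining relations give an algebra homomorphism. -/
def lift {A : Type*} [Ring A] [Algebra ℂ A] (f : B → A) (hq : ∀ s, f s * f s = -f s)
    (hb : ∀ s t, s ≠ t → M s t ≠ 0 →
      ((CoxeterSystem.alternatingWord s t (M s t)).map f).prod =
        ((CoxeterSystem.alternatingWord t s (M s t)).map f).prod) :
    ZeroHecke M →ₐ[ℂ] A :=
  RingQuot.liftAlgHom ℂ ⟨FreeAlgebra.lift ℂ f, by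
    rintro _ _ (⟨s⟩ | ⟨s, t, hst, hm⟩)
    · simpa using hq s
    · simpa [map_list_prod, Function.comp_def] using hb s t hst hm⟩

theorem lift_gen {A : Type*} [Ring A] [Algebra ℂ A] (f : B → A) (hq hb) (s : B) :
    lift (M := M) f hq hb (gen M s) = f s := by
  simp [lift, gen]

theorem induction {P : ZeroHecke M → Prop} (hc : ∀ c : ℂ, P (algebraMap ℂ _ c))
    (hg : ∀ s, P (gen M s)) (ha : ∀ a b, P a → P b → P (a + b))
    (hm : ∀ a b, P a → P b → P (a * b)) (a : ZeroHecke M) : P a := by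
  obtain ⟨x, rfl⟩ := RingQuot.mkAlgHom_surjective ℂ (HeckeRel M) a
  induction x using FreeAlgebra.induction with
  | grade0 c => simpa using hc c
  | grade1 s => exact hg s
  | mul a b h1 h2 => rw [map_mul]; exact hm _ _ h1 h2
  | add a b h1 h2 => rw [map_add]; exact ha _ _ h1 h2

open Classical in
theorem char_braid (I : Set B) (s t : B) (m : ℕ) (hm : 2 ≤ m) :
    ((CoxeterSystem.alternatingWord s t m).map (fun j => if j ∈ I then (-1 : ℂ) else 0)).prod =
      ((CoxeterSystem.alternatingWord t s m).map (fun j => if j ∈ I then (-1 : ℂ) else 0)).prod := by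
  obtain ⟨m, rfl⟩ : ∃ k, m = k + 2 := ⟨m - 2, by omega⟩
  by_cases hs : s ∈ I <;> by_cases ht : t ∈ I
  · have key : ∀ (k : ℕ) (a b : B), a ∈ I → b ∈ I →
        ((CoxeterSystem.alternatingWord a b k).map
          (fun j => if j ∈ I then (-1 : ℂ) else 0)).prod = (-1) ^ k := by
      intro k
      induction k with
      | zero => intro a b _ _; simp [CoxeterSystem.alternatingWord]
      | succ k ih =>
        intro a b ha hb
        simp [CoxeterSystem.alternatingWord, ih b a hb ha, hb, pow_succ]
    rw [key _ _ _ hs ht, key _ _ _ ht hs]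
  all_goals simp [CoxeterSystem.alternatingWord, hs, ht]

open Classical in
/-- The character of the one-dimensional module attached to `I`:
`π_j ↦ -1` if `j ∈ I` and `π_j ↦ 0` otherwise. -/
noncomputable def char (I : Set B) : ZeroHecke M →ₐ[ℂ] ℂ :=
  lift (fun j => if j ∈ I then -1 else 0) (fun s => by split <;> simp) fun s t hst h0 =>
    char_braid I s t _ (by have := M.off_diagonal s t hst; omega)

/-- The simple module `𝒮_I`, as an action on `ℂ` (with basis element `ε_I = 1`). -/
noncomputable def simpleRep (I : Set B) : ZeroHecke M →ₐ[ℂ] Module.End ℂ ℂ :=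
  (Algebra.lmul ℂ ℂ).comp (char I)

end ZeroHecke

end Hecke

section Grothendieck

/-- The defining relations `[A] - [B] + [C]` of the Grothendieck group, one for each short exact
sequence `0 → A → B → C → 0` of finitely generated modules. -/
def exactRelations (R : Type) [Ring R] : Set (FreeAbelianGroup (FGModuleCat.{0} R)) :=
  {z | ∃ (A B C : FGModuleCat.{0} R) (f : A →ₗ[R] B) (g : B →ₗ[R] C),
    Function.Injective f ∧ Function.Exact f g ∧ Function.Surjective g ∧
    z = FreeAbelianGroup.of A - FreeAbelianGroup.of B + FreeAbelianGroup.of C}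

/-- The Grothendieck group `𝒢₀(R)` of finitely generated `R`-modules. Isomorphic modules have the
same class, because of the exact sequences `0 → A → B → 0 → 0`. -/
abbrev G0 (R : Type) [Ring R] : Type 1 :=
  FreeAbelianGroup (FGModuleCat.{0} R) ⧸ AddSubgroup.closure (exactRelations R)

/-- The class `[M]` of a finitely generated module. -/
def G0.mk {R : Type} [Ring R] (M : FGModuleCat.{0} R) : G0 R :=
  QuotientAddGroup.mk (FreeAbelianGroup.of M)

theorem G0.mk_eq {R : Type} [Ring R] {A B C : FGModuleCat.{0} R} (f : A →ₗ[R] B)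
    (g : B →ₗ[R] C) (hf : Function.Injective f) (hfg : Function.Exact f g)
    (hg : Function.Surjective g) : G0.mk B = G0.mk A + G0.mk C := by
  have h : (QuotientAddGroup.mk (FreeAbelianGroup.of A - FreeAbelianGroup.of B +
      FreeAbelianGroup.of C) : G0 R) = 0 :=
    (QuotientAddGroup.eq_zero_iff _).2
      (AddSubgroup.subset_closure ⟨A, B, C, f, g, hf, hfg, hg, rfl⟩)
  have h' : G0.mk A - G0.mk B + G0.mk C = 0 := h
  rw [← sub_eq_zero, ← neg_eq_zero, ← h']
  abel

variable {A : Type} [Ring A] [Algebra ℂ A]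

/-- The `A`-module given by an action `ρ` of `A` on a finite-dimensional complex vector space. -/
def moduleOfRep {V : Type} [AddCommGroup V] [Module ℂ V] (ρ : A →ₐ[ℂ] Module.End ℂ V)
    (hV : Module.Finite ℂ V) : FGModuleCat.{0} A :=
  letI : Module A V := Module.compHom V ρ.toRingHom
  haveI : IsScalarTower ℂ A V := ⟨fun c a v => by
    change ρ (c • a) v = c • ρ a v
    rw [map_smul, LinearMap.smul_apply]⟩
  haveI : Module.Finite A V := Module.Finite.of_restrictScalars_finite ℂ A V
  FGModuleCat.of A V

theorem trace_of_exact {K U V W : Type*} [Field K] [AddCommGroup U] [Module K U]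
    [AddCommGroup V] [Module K V] [AddCommGroup W] [Module K W] [Module.Finite K U]
    [Module.Finite K V] [Module.Finite K W] (f : U →ₗ[K] V) (g : V →ₗ[K] W)
    (hf : Function.Injective f) (hfg : Function.Exact f g) (hg : Function.Surjective g)
    (a : Module.End K U) (b : Module.End K V) (c : Module.End K W)
    (hab : f ∘ₗ a = b ∘ₗ f) (hbc : g ∘ₗ b = c ∘ₗ g) :
    LinearMap.trace K V b = LinearMap.trace K U a + LinearMap.trace K W c := by
  obtain ⟨σ, hσ⟩ := g.exists_rightInverse_of_surjective (LinearMap.range_eq_top.2 hg)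
  obtain ⟨r, hr⟩ := f.exists_leftInverse_of_injective (LinearMap.ker_eq_bot.2 hf)
  set r' : V →ₗ[K] U := r ∘ₗ (LinearMap.id - σ ∘ₗ g) with hr'
  have hgf : g ∘ₗ f = 0 := LinearMap.ext fun x => hfg.apply_apply_eq_zero x
  have h1 : f ∘ₗ r' + σ ∘ₗ g = LinearMap.id := by
    ext x
    have hx : g (x - σ (g x)) = 0 := by
      rw [map_sub, ← LinearMap.comp_apply g σ, hσ]; simp
    obtain ⟨y, hy⟩ := (hfg _).1 hx
    have : r (f y) = y := LinearMap.congr_fun hr y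
    simp [hr', ← hy, this]
    rw [hy]
    abel
  have h2 : r' ∘ₗ f = LinearMap.id := by
    rw [hr', LinearMap.comp_assoc, LinearMap.sub_comp, LinearMap.comp_assoc, hgf]
    simpa using hr
  have h3 : b = (b ∘ₗ f) ∘ₗ r' + (b ∘ₗ σ) ∘ₗ g := by
    rw [LinearMap.comp_assoc, LinearMap.comp_assoc, ← LinearMap.comp_add, h1, LinearMap.comp_id]
  rw [h3, map_add, LinearMap.trace_comp_comm', LinearMap.trace_comp_comm' g (b ∘ₗ σ), ← hab,
    ← LinearMap.comp_assoc, h2, ← LinearMap.comp_assoc, hbc, LinearMap.comp_assoc, hσ,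
    LinearMap.id_comp, LinearMap.comp_id]

/-- The complex vector space structure of an `A`-module. -/
abbrev complexModule (A : Type) [Ring A] [Algebra ℂ A] (V : Type*) [AddCommGroup V] [Module A V] :
    Module ℂ V := Module.compHom V (algebraMap ℂ A)

theorem complexModule_tower (V : Type*) [AddCommGroup V] [Module A V] :
    let := complexModule A V
    IsScalarTower ℂ A V := by
  let := complexModule A V
  refine ⟨fun c a v => ?_⟩
  change (c • a) • v = algebraMap ℂ A c • a • v
  rw [Algebra.smul_def, mul_smul]

/-- The trace of `a : A` on an `A`-module. -/
noncomputable def traceOn (a : A) (V : Type*) [AddCommGroup V] [Module A V] : ℂ :=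
  letI := complexModule A V
  haveI := complexModule_tower (A := A) V
  LinearMap.trace ℂ V (Algebra.lsmul ℂ ℂ V a)

theorem complexModule_finite [Module.Finite ℂ A] (V : Type*) [AddCommGroup V] [Module A V]
    [Module.Finite A V] :
    let := complexModule A V
    Module.Finite ℂ V := by
  let := complexModule A V
  have := complexModule_tower (A := A) V
  exact Module.Finite.trans A V

theorem traceOn_exact [Module.Finite ℂ A] (a : A) {U V W : FGModuleCat.{0} A} (f : U →ₗ[A] V)
    (g : V →ₗ[A] W) (hf : Function.Injective f) (hfg : Function.Exact f g)
    (hg : Function.Surjective g) : traceOn a V = traceOn a U + traceOn a W := by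
  let := complexModule A U
  let := complexModule A V
  let := complexModule A W
  have := complexModule_tower (A := A) U
  have := complexModule_tower (A := A) V
  have := complexModule_tower (A := A) W
  have := complexModule_finite (A := A) U
  have := complexModule_finite (A := A) V
  have := complexModule_finite (A := A) W
  exact trace_of_exact (f.restrictScalars ℂ) (g.restrictScalars ℂ) hf hfg hg _ _ _
    (by ext x; simp) (by ext x; simp)

/-- The homomorphism on the Grothendieck group induced by the trace of `a`. -/
noncomputable def traceHom [Module.Finite ℂ A] (a : A) : G0 A →+ ℂ :=
  QuotientAddGroup.lift _ (FreeAbelianGroup.lift fun V : FGModuleCat.{0} A => traceOn a V) (by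
    rw [AddSubgroup.closure_le]
    rintro _ ⟨U, V, W, f, g, hf, hfg, hg, rfl⟩
    have := traceOn_exact a f g hf hfg hg
    simp [this])

theorem traceHom_mk [Module.Finite ℂ A] (a : A) (V : FGModuleCat.{0} A) :
    traceHom a (G0.mk V) = traceOn a V := by
  simp [traceHom, G0.mk]

end Grothendieck

section TypeBSpecific

variable {n : ℕ}

/-- Extension of a family indexed by `Fin n` to all natural indices. -/
def extend {G : Type*} [Monoid G] (f : Fin n → G) (i : ℕ) : G :=
  if h : i < n then f ⟨i, h⟩ else 1

theorem extend_of_lt {G : Type*} [Monoid G] (f : Fin n → G) {i : ℕ} (h : i < n) :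
    extend f i = f ⟨i, h⟩ := dif_pos h

theorem chainRel_extend {G : Type*} [Monoid G] (f : Fin n → G)
    (hsq : ∀ i, f i * f i = 1 ∨ f i * f i = f i)
    (hb : ∀ i j, i ≠ j → ((CoxeterSystem.alternatingWord i j (matrixB n i j)).map f).prod =
      ((CoxeterSystem.alternatingWord j i (matrixB n i j)).map f).prod) :
    ChainRel (extend f) n where
  sq i hi := by rw [extend_of_lt f hi]; exact hsq _
  comm i j hij hj := by
    have hi : i < n := by omega
    rw [extend_of_lt f hi, extend_of_lt f hj]
    have hM : matrixB n ⟨i, hi⟩ ⟨j, hj⟩ = 2 := by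
      rw [matrixB_apply, if_neg (by simp; omega), if_neg (by simp; omega)]
    have := hb ⟨i, hi⟩ ⟨j, hj⟩ (by simp; omega)
    rw [hM] at this
    simpa [CoxeterSystem.alternatingWord] using this
  braid i h1 hi := by
    have hi' : i < n := by omega
    rw [extend_of_lt f hi, extend_of_lt f hi']
    have hM : matrixB n ⟨i, hi'⟩ ⟨i + 1, hi⟩ = 3 := by
      rw [matrixB_apply, if_neg (by simp), if_pos (by simp), if_neg (by simp; omega)]
    have := hb ⟨i, hi'⟩ ⟨i + 1, hi⟩ (by simp)
    rw [hM] at this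
    simpa [CoxeterSystem.alternatingWord, mul_assoc] using this.symm
  four h1 := by
    have h0 : 0 < n := by omega
    rw [extend_of_lt f h0, extend_of_lt f h1]
    have hM : matrixB n ⟨0, h0⟩ ⟨1, h1⟩ = 4 := by
      rw [matrixB_apply, if_neg (by simp), if_pos (by simp), if_pos (by simp)]
    have := hb ⟨0, h0⟩ ⟨1, h1⟩ (by simp)
    rw [hM] at this
    simpa [CoxeterSystem.alternatingWord, mul_assoc] using this

theorem finite_closure_range {G : Type*} [Monoid G] (f : Fin n → G)
    (H : ChainRel (extend f) n) : (Submonoid.closure (Set.range f) : Set G).Finite := by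
  have h := finite_closure H n le_rfl
  convert h using 3
  ext x
  constructor
  · rintro ⟨i, rfl⟩
    exact ⟨i, i.2, extend_of_lt f i.2⟩
  · rintro ⟨i, hi, rfl⟩
    exact ⟨⟨i, hi⟩, (extend_of_lt f hi).symm⟩

/-- The hyperoctahedral group is finite. -/
theorem finite_group {W : Type*} [Group W] (cs : CoxeterSystem (matrixB n) W) : Finite W := by
  have H : ChainRel (extend cs.simple) n := chainRel_extend _
    (fun i => Or.inl (cs.simple_mul_simple_self i)) (fun i j _ => by
      have := cs.wordProd_braidWord_eq i j
      rw [CoxeterSystem.braidWord, CoxeterSystem.braidWord, (matrixB n).symmetric j i] at this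
      exact this)
  have := finite_closure_range _ H
  rw [cs.submonoid_closure_range_simple] at this
  exact Set.finite_univ_iff.1 this

theorem chainRel_neg {A : Type*} [Ring A] (f : Fin n → A) (hq : ∀ i, f i * f i = -f i)
    (hb : ∀ i j, i ≠ j → ((CoxeterSystem.alternatingWord i j (matrixB n i j)).map f).prod =
      ((CoxeterSystem.alternatingWord j i (matrixB n i j)).map f).prod) :
    ChainRel (extend fun i => -f i) n := by
  have key : ∀ l : List (Fin n),
      (l.map fun i => -f i).prod = (-1) ^ l.length * (l.map f).prod := by
    intro l
    induction l with
    | nil => simp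
    | cons a l ih =>
      rw [List.map_cons, List.prod_cons, ih, List.map_cons, List.prod_cons, List.length_cons,
        pow_succ', neg_mul, ← mul_assoc, ← ((Commute.neg_one_left (f a)).pow_left _).eq]
      simp [mul_assoc]
  refine chainRel_extend _ (fun i => Or.inr (by simp [hq])) fun i j hij => ?_
  rw [key, key, hb i j hij]
  simp

theorem matrixB_ne_zero (i j : Fin n) : matrixB n i j ≠ 0 := by
  rw [matrixB_apply]
  split_ifs <;> simp

/-- The type-`B` `0`-Hecke algebra `H_n^B(0)`. -/
abbrev HeckeB (n : ℕ) : Type := ZeroHecke (matrixB n)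

instance : Module.Finite ℂ (HeckeB n) := by
  have H : ChainRel (extend fun i => -ZeroHecke.gen (matrixB n) i) n :=
    chainRel_neg _ ZeroHecke.gen_sq fun i j hij => ZeroHecke.gen_braid i j hij (matrixB_ne_zero i j)
  have hfin := finite_closure_range _ H
  set N := Submonoid.closure (Set.range fun i => -ZeroHecke.gen (matrixB n) i) with hN
  have htop : Submodule.span ℂ (N : Set (HeckeB n)) = ⊤ := by
    rw [eq_top_iff]
    rintro a -
    rw [hN, ← Algebra.adjoin_eq_span, Subalgebra.mem_toSubmodule]
    induction a using ZeroHecke.induction with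
    | hc c => exact Subalgebra.algebraMap_mem _ c
    | hg s =>
      rw [← neg_neg (ZeroHecke.gen _ s)]
      exact Subalgebra.neg_mem _ (Algebra.subset_adjoin ⟨s, rfl⟩)
    | ha a b h1 h2 => exact Subalgebra.add_mem _ h1 h2
    | hm a b h1 h2 => exact Subalgebra.mul_mem _ h1 h2
  exact ⟨⟨hfin.toFinset, by simpa using htop⟩⟩

/-- The class `[𝒮_I^B]` of the simple `H_n^B(0)`-module indexed by `I ⊆ {0, …, n-1}`. -/
noncomputable def simpleClass (I : Set (Fin n)) : G0 (HeckeB n) :=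
  G0.mk (moduleOfRep (ZeroHecke.simpleRep I) inferInstance)

/-- The type-`B` fundamental quasisymmetric function `F^B_I` of degree `n`, for
`I ⊆ {0, …, n-1}`, as a power series in `x_0, x_1, x_2, …`: the coefficient of a monomial is the
number of sequences `0 = i_0 ≤ i_1 ≤ ⋯ ≤ i_n`, with `i_j < i_{j+1}` for `j ∈ I`, for which
`x_{i_1} ⋯ x_{i_n}` is this monomial. -/
noncomputable def fundamentalB (n : ℕ) (I : Set (Fin n)) : MvPowerSeries ℕ ℂ := fun d =>
  (Set.ncard {i : Fin (n + 1) → ℕ | i 0 = 0 ∧ Monotone i ∧ (∀ j ∈ I, i j.castSucc < i j.succ) ∧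
    ∑ j : Fin n, Finsupp.single (i j.succ) 1 = d} : ℂ)

open Classical in
/-- An element whose trace on `𝒮_J^B` is `1` if `I = J` and `0` otherwise. -/
noncomputable def dualElement (I : Set (Fin n)) : HeckeB n :=
  (List.ofFn fun i => if i ∈ I then -ZeroHecke.gen (matrixB n) i
    else 1 + ZeroHecke.gen (matrixB n) i).prod

open Classical in
theorem char_dualElement (I J : Set (Fin n)) :
    ZeroHecke.char J (dualElement I) = if I = J then 1 else 0 := by
  rw [dualElement, map_list_prod, List.map_ofFn, List.prod_ofFn]
  have : ∀ i, (ZeroHecke.char J ∘ fun i => if i ∈ I then -ZeroHecke.gen (matrixB n) i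
      else 1 + ZeroHecke.gen (matrixB n) i) i = if (i ∈ I ↔ i ∈ J) then 1 else 0 := by
    intro i
    by_cases hI : i ∈ I <;> by_cases hJ : i ∈ J <;>
      simp [hI, hJ, ZeroHecke.char, ZeroHecke.lift_gen]
  simp_rw [this]
  rw [Finset.prod_ite_zero]
  simp [Set.ext_iff]

theorem traceHom_simpleClass (a : HeckeB n) (J : Set (Fin n)) :
    traceHom a (simpleClass J) = ZeroHecke.char J a := by
  rw [simpleClass, traceHom_mk]
  set V := moduleOfRep (A := HeckeB n) (ZeroHecke.simpleRep J) inferInstance with hV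
  let := complexModule (HeckeB n) V
  have := complexModule_tower (A := HeckeB n) V
  have hsm : ∀ (a : HeckeB n) (x : ℂ), (a • (show V from x) : V) =
    (show V from ZeroHecke.char J a * x) := fun a x => rfl
  have h1 : (Algebra.lsmul ℂ ℂ V a : V →ₗ[ℂ] V) = ZeroHecke.char J a • LinearMap.id := by
    ext x
    change a • x = algebraMap ℂ (HeckeB n) (ZeroHecke.char J a) • x
    rw [hsm a x, hsm _ x, AlgHom.commutes]
    rfl
  have h2 : Module.finrank ℂ V = 1 := by
    refine finrank_eq_one (show V from (1 : ℂ)) (one_ne_zero (α := ℂ)) fun w => ⟨(show ℂ from w), ?_⟩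
    change (ZeroHecke.char J (algebraMap ℂ (HeckeB n) (show ℂ from w)) * 1 : ℂ) = w
    rw [AlgHom.commutes]
    exact mul_one (show ℂ from w)
  have := complexModule_finite (A := HeckeB n) V
  change LinearMap.trace ℂ V (Algebra.lsmul ℂ ℂ V a) = _
  rw [h1, map_smul, LinearMap.trace_id, h2]
  simp

theorem exists_characteristic (n : ℕ) : ∃ ch : G0 (HeckeB n) →+ MvPowerSeries ℕ ℂ,
    ∀ I, ch (simpleClass I) = fundamentalB n I := by
  classical
  refine ⟨∑ I : Set (Fin n), ((AddMonoidHom.flip (smulAddHom ℂ (MvPowerSeries ℕ ℂ))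
    (fundamentalB n I)).comp (traceHom (dualElement I))), fun J => ?_⟩
  simp [traceHom_simpleClass, char_dualElement]

theorem mk_mem_closure : ∀ (d : ℕ) (V : FGModuleCat.{0} (HeckeB n)),
    (let := complexModule (HeckeB n) V; Module.finrank ℂ V = d) →
    G0.mk V ∈ AddSubgroup.closure (Set.range (simpleClass (n := n))) := by
  classical
  intro d
  induction d using Nat.strong_induction_on with
  | _ d ih =>
  intro V hd
  let := complexModule (HeckeB n) V
  have := complexModule_tower (A := HeckeB n) V
  have := complexModule_finite (A := HeckeB n) V
  rcases subsingleton_or_nontrivial V with hV | hV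
  · have h : G0.mk V = G0.mk V + G0.mk V :=
      G0.mk_eq (LinearMap.id : V →ₗ[HeckeB n] V) (0 : V →ₗ[HeckeB n] V)
        (fun _ _ _ => Subsingleton.elim _ _)
        (fun x => ⟨fun _ => ⟨x, rfl⟩, fun _ => rfl⟩) (fun x => ⟨x, Subsingleton.elim _ _⟩)
    rw [left_eq_add.1 h]
    exact AddSubgroup.zero_mem _
  · have hq : ∀ i, (Algebra.lsmul ℂ ℂ V (ZeroHecke.gen (matrixB n) i)) *
        (Algebra.lsmul ℂ ℂ V (ZeroHecke.gen (matrixB n) i)) =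
        -(Algebra.lsmul ℂ ℂ V (ZeroHecke.gen (matrixB n) i)) := by
      intro i
      rw [← map_mul, ZeroHecke.gen_sq, map_neg]
    have H := chainRel_neg (fun i => Algebra.lsmul ℂ ℂ V (ZeroHecke.gen (matrixB n) i)) hq
      (fun i j hij => by
        have := congrArg (Algebra.lsmul ℂ ℂ V)
          (ZeroHecke.gen_braid (M := matrixB n) i j hij (matrixB_ne_zero i j))
        simp only [map_list_prod, List.map_map] at this
        exact this)
    obtain ⟨v, hv, hev⟩ := exists_eigenvector H (fun i hi => by
      rw [extend_of_lt _ hi, neg_mul_neg, hq]) n le_rfl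
    let I : Set (Fin n) := {i | ZeroHecke.gen (matrixB n) i • v = -v}
    have hgen : ∀ i, ZeroHecke.gen (matrixB n) i • v =
        ZeroHecke.char I (ZeroHecke.gen (matrixB n) i) • v := by
      intro i
      rw [ZeroHecke.char, ZeroHecke.lift_gen]
      by_cases hi : i ∈ I
      · have hi' : ZeroHecke.gen (matrixB n) i • v = -v := hi
        rw [if_pos hi, neg_one_smul, hi']
      · rw [if_neg hi, zero_smul]
        obtain ⟨c, hc⟩ := hev i i.2
        rw [extend_of_lt _ i.2] at hc
        have hc : ZeroHecke.gen (matrixB n) i • v = (-c) • v := by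
          rw [neg_smul, ← hc]; simp
        have h2 : ZeroHecke.gen (matrixB n) i • ZeroHecke.gen (matrixB n) i • v =
            -(ZeroHecke.gen (matrixB n) i • v) := by
          rw [← mul_smul, ZeroHecke.gen_sq, neg_smul]
        rw [hc, smul_comm, hc, ← sub_eq_zero, ← neg_smul, smul_smul, ← sub_smul,
          smul_eq_zero_iff_left hv] at h2
        have hc1 : c ≠ 1 := by
          rintro rfl
          exact hi (by change _ = _; rw [hc, neg_one_smul])
        have hc0 : c = 0 := by
          have : c * (c - 1) = 0 := by linear_combination h2
          rcases mul_eq_zero.1 this with h | h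
          · exact h
          · exact absurd (sub_eq_zero.1 h) hc1
        rw [hc, hc0, neg_zero, zero_smul]
    have hact : ∀ a : HeckeB n, a • v = ZeroHecke.char I a • v := by
      intro a
      induction a using ZeroHecke.induction with
      | hc c => rw [AlgHom.commutes]; rfl
      | hg s => exact hgen s
      | ha a b h1 h2 => rw [add_smul, h1, h2, map_add, add_smul]
      | hm a b h1 h2 => rw [mul_smul, h2, smul_comm, h1, map_mul, mul_comm, mul_smul]
    let S := moduleOfRep (A := HeckeB n) (ZeroHecke.simpleRep I) inferInstance
    let f : S →ₗ[HeckeB n] V :=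
      { toFun := fun z => (show ℂ from z) • v
        map_add' := fun x y => add_smul (show ℂ from x) (show ℂ from y) v
        map_smul' := fun a x => by
          change (ZeroHecke.char I a * (show ℂ from x)) • v = a • (show ℂ from x) • v
          rw [smul_comm, hact, smul_smul, mul_comm] }
    have hf : Function.Injective f := fun x y hxy => smul_left_injective ℂ hv hxy
    let N : Submodule (HeckeB n) V := LinearMap.range f
    let Q : FGModuleCat.{0} (HeckeB n) := FGModuleCat.of (HeckeB n) (V ⧸ N)
    have hmk : G0.mk V = simpleClass I + G0.mk Q :=
      G0.mk_eq (C := Q) f N.mkQ hf (LinearMap.exact_map_mkQ_range f) N.mkQ_surjective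
    rw [hmk]
    refine AddSubgroup.add_mem _ (AddSubgroup.subset_closure ⟨I, rfl⟩) (ih _ ?_ Q rfl)
    let := complexModule (HeckeB n) (V ⧸ N)
    have := complexModule_tower (A := HeckeB n) (V ⧸ N)
    have := complexModule_finite (A := HeckeB n) (V ⧸ N)
    rw [← hd]
    change Module.finrank ℂ (V ⧸ N) < _
    have hle := LinearMap.finrank_range_add_finrank_ker (N.mkQ.restrictScalars ℂ)
    have hr : LinearMap.range (N.mkQ.restrictScalars ℂ) = ⊤ :=
      LinearMap.range_eq_top.2 N.mkQ_surjective
    have hker : 0 < Module.finrank ℂ (LinearMap.ker (N.mkQ.restrictScalars ℂ)) := by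
      rw [Module.finrank_pos_iff_exists_ne_zero]
      refine ⟨⟨v, ?_⟩, fun h => hv (congrArg Subtype.val h)⟩
      rw [LinearMap.mem_ker]
      change N.mkQ v = 0
      rw [Submodule.mkQ_apply, Submodule.Quotient.mk_eq_zero]
      exact ⟨(show S from (1 : ℂ)), one_smul ℂ v⟩
    rw [hr, finrank_top] at hle
    omega

/-- There is exactly one homomorphism on `𝒢₀(H_n^B(0))` that sends `[𝒮_I^B]` to `F^B_I` for
all `I`. -/
theorem existsUnique_characteristic (n : ℕ) : ∃! ch : G0 (HeckeB n) →+ MvPowerSeries ℕ ℂ,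
    ∀ I, ch (simpleClass I) = fundamentalB n I := by
  obtain ⟨ch, hch⟩ := exists_characteristic n
  refine ⟨ch, hch, fun ch' hch' => ?_⟩
  have hcl : AddSubgroup.closure (Set.range (simpleClass (n := n))) = ⊤ := by
    rw [eq_top_iff]
    rintro x -
    obtain ⟨z, rfl⟩ := QuotientAddGroup.mk_surjective x
    induction z using FreeAbelianGroup.induction_on with
    | zero => exact AddSubgroup.zero_mem _
    | of V => exact mk_mem_closure _ V rfl
    | neg V h => exact AddSubgroup.neg_mem _ h
    | add x y hx hy => exact AddSubgroup.add_mem _ hx hy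
  refine AddMonoidHom.eq_of_eqOn_dense hcl ?_
  rintro _ ⟨I, rfl⟩
  rw [hch, hch']

/-- The type-`B` quasisymmetric characteristic `ch^B`: the unique homomorphism on `𝒢₀(H_n^B(0))`
with `ch^B([𝒮_I^B]) = F^B_I` for all `I ⊆ {0, …, n-1}`. -/
noncomputable def chB (n : ℕ) : G0 (HeckeB n) →+ MvPowerSeries ℕ ℂ :=
  (existsUnique_characteristic n).choose

theorem chB_simpleClass (I : Set (Fin n)) : chB n (simpleClass I) = fundamentalB n I :=
  (existsUnique_characteristic n).choose_spec.1 I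

end TypeBSpecific

section AscentCompatible

variable {B W : Type} [Group W] {M : CoxeterMatrix B} (cs : CoxeterSystem M W)

/-- The set of (left) descents of `w`. -/
def Des (w : W) : Set B := {s | cs.IsLeftDescent w s}

/-- The quadruple `(u, v, s, t)` is aligned. -/
def Aligned (u v : W) (s t : B) : Prop :=
  s ∉ Des cs u ∧ t ∉ Des cs v ∧ u⁻¹ * cs.simple s * u = v⁻¹ * cs.simple t * v

/-- Ascent-compatible subsets of a Coxeter group. -/
def AscentCompatible (X : Set W) : Prop :=
  ∀ u ∈ X, ∀ v ∈ X, ∀ s t : B, Aligned cs u v s t →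
    (cs.simple s * u ∈ X ↔ cs.simple t * v ∈ X)

open Classical in
/-- The linear operator `π_s` on `ℂX`. -/
noncomputable def piOp (X : Set W) (s : B) : Module.End ℂ (X →₀ ℂ) :=
  Finsupp.linearCombination ℂ fun x : X =>
    if s ∈ Des cs (x : W) then -Finsupp.single x 1
    else if h : cs.simple s * (x : W) ∈ X then Finsupp.single ⟨cs.simple s * (x : W), h⟩ 1
    else 0

end AscentCompatible

/-- `ℂX` is finite-dimensional for every subset `X` of the hyperoctahedral group. -/
theorem finite_free {n : ℕ} {W : Type} [Group W] (cs : CoxeterSystem (matrixB n) W) (X : Set W) :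
    Module.Finite ℂ (X →₀ ℂ) := by
  have := finite_group cs
  infer_instance

end TypeB

/-! The braid relations are checked on one dihedral coset `⟨s, t⟩ u` at a time, with `u` its
shortest element. The coset consists of two chains that rise from `u` to a common top, where `π_s`
and `π_t` both act by `-1`. An alternating product of the operators either climbs one of the chains
or leaves `X` and gives zero. By the strong exchange property the chains ascend up to their common
end, and the reflections met along one of them are those met along the other, in the opposite order;
ascent-compatibility therefore makes both chains stay in `X` or neither.

For the characteristic, the action on `ℂX` is triangular with respect to length, with the character
of `S_Des(x)` as diagonal entry at `x`. Splitting off an element of `X` of minimal length, one at a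
time, gives `[ℂX] = ∑ [S_Des(x)]` in the Grothendieck group. -/

open CoxeterSystem

namespace TypeB

section DihedralProducts

variable {B W : Type*} [Group W] {M : CoxeterMatrix B} (cs : CoxeterSystem M W)

/-- The alternating product `⋯ s t s t` of `k` simple reflections, the last of which is `t`. -/
def altProd (s t : B) (k : ℕ) : W := cs.wordProd (alternatingWord s t k)

@[simp]
theorem altProd_zero (s t : B) : altProd cs s t 0 = 1 := by
  simp [altProd, alternatingWord]

theorem altProd_succ (s t : B) (k : ℕ) :
    altProd cs s t (k + 1) = altProd cs t s k * cs.simple t := by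
  rw [altProd, alternatingWord_succ, wordProd_concat, altProd]

theorem inv_altProd_succ (s t : B) (k : ℕ) :
    (altProd cs s t (k + 1))⁻¹ = cs.simple t * (altProd cs t s k)⁻¹ := by
  rw [altProd_succ, mul_inv_rev, inv_simple]

theorem exists_altProd_succ_eq_simple_mul (s t : B) (k : ℕ) :
    ∃ r, altProd cs s t (k + 1) = cs.simple r * altProd cs s t k :=
  ⟨_, by rw [altProd, alternatingWord_succ', wordProd_cons, altProd]⟩

theorem altProd_mem_closure (s t : B) (k : ℕ) :
    altProd cs s t k ∈ Subgroup.closure {cs.simple s, cs.simple t} := by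
  induction k generalizing s t with
  | zero => simp [one_mem]
  | succ k ih =>
    rw [altProd_succ]
    exact mul_mem (Set.pair_comm (cs.simple t) _ ▸ ih t s) (Subgroup.subset_closure (by simp))

theorem inv_altProd_mul_altProd_succ (s t : B) (k : ℕ) :
    (altProd cs s t k)⁻¹ * altProd cs s t (k + 1) =
      cs.simple t * (cs.simple s * cs.simple t) ^ k := by
  induction k generalizing s t with
  | zero => simp [altProd_succ]
  | succ k ih =>
    rw [inv_altProd_succ, altProd_succ cs s t (k + 1), mul_assoc, ← mul_assoc (_)⁻¹, ih,
      ← mul_pow_mul, mul_assoc, ← pow_succ]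

theorem rightInvSeq_alternatingWord (s t : B) (k : ℕ) :
    cs.rightInvSeq (alternatingWord s t k) =
      (List.range k).reverse.map fun j => cs.simple t * (cs.simple s * cs.simple t) ^ j := by
  induction k with
  | zero => simp [alternatingWord]
  | succ k ih =>
    rw [List.range_succ, List.reverse_append, List.reverse_singleton, List.singleton_append,
      List.map_cons, ← ih, ← inv_altProd_mul_altProd_succ, altProd, altProd, alternatingWord_succ',
      rightInvSeq, wordProd_cons, mul_assoc]

theorem orderOf_simple_mul_simple_comm (s t : B) :
    orderOf (cs.simple s * cs.simple t) = orderOf (cs.simple t * cs.simple s) := by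
  rw [← orderOf_inv, mul_inv_rev, inv_simple, inv_simple]

theorem altProd_swap (s t : B) (k : ℕ) :
    altProd cs t s k = altProd cs s t k * (cs.simple t * cs.simple s) ^ k := by
  induction k generalizing s t with
  | zero => simp
  | succ k ih =>
    rw [altProd_succ, altProd_succ, ih t s, pow_succ', mul_assoc _ (cs.simple t), mul_assoc,
      mul_pow_mul, mul_assoc (cs.simple t), simple_mul_simple_cancel_left]

theorem altProd_orderOf_swap (s t : B) :
    altProd cs s t (orderOf (cs.simple s * cs.simple t)) =
      altProd cs t s (orderOf (cs.simple s * cs.simple t)) := by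
  rw [altProd_swap cs t s, pow_orderOf_eq_one, mul_one]

theorem simple_mul_pow_eq_of_add_eq_orderOf {s t : B} {k l : ℕ}
    (h : k + l + 1 = orderOf (cs.simple s * cs.simple t)) :
    cs.simple t * (cs.simple s * cs.simple t) ^ k =
      cs.simple s * (cs.simple t * cs.simple s) ^ l := by
  have hinv : cs.simple t * cs.simple s = (cs.simple s * cs.simple t)⁻¹ := by simp
  apply mul_left_cancel (a := cs.simple s)
  rw [← mul_assoc, ← pow_succ', simple_mul_simple_cancel_left, hinv, inv_pow,
    eq_inv_iff_mul_eq_one, ← pow_add, add_right_comm, h, pow_orderOf_eq_one]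

/-- The inverses of the alternating products of `s` and `t` with at most `orderOf (s t)` factors.
When the order is finite, they make up the dihedral subgroup generated by `s` and `t`. -/
def invAltProds (s t : B) : Set W :=
  {g | ∃ k ≤ orderOf (cs.simple s * cs.simple t),
    g = (altProd cs s t k)⁻¹ ∨ g = (altProd cs t s k)⁻¹}

theorem invAltProds_comm (s t : B) : invAltProds cs s t = invAltProds cs t s := by
  simp only [invAltProds, orderOf_simple_mul_simple_comm cs s t, or_comm]

theorem simple_mul_mem_invAltProds {s t : B} {g : W}
    (hpos : 0 < orderOf (cs.simple s * cs.simple t)) (hg : g ∈ invAltProds cs s t) :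
    cs.simple s * g ∈ invAltProds cs s t := by
  obtain ⟨k, hk, rfl | rfl⟩ := hg
  · rcases hk.lt_or_eq with hlt | rfl
    · exact ⟨k + 1, hlt, Or.inr (inv_altProd_succ cs t s k).symm⟩
    · obtain ⟨l, hl⟩ := Nat.exists_eq_add_one.2 hpos
      refine ⟨l, by omega, Or.inl ?_⟩
      rw [altProd_orderOf_swap, hl, inv_altProd_succ, simple_mul_simple_cancel_left]
  · cases k with
    | zero => exact ⟨1, hpos, Or.inr (by simp [altProd_succ])⟩
    | succ l =>
      exact ⟨l, by omega, Or.inl (by rw [inv_altProd_succ, simple_mul_simple_cancel_left])⟩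

theorem mem_invAltProds_of_mem_closure {s t : B} {g : W}
    (hpos : 0 < orderOf (cs.simple s * cs.simple t))
    (hg : g ∈ Subgroup.closure {cs.simple s, cs.simple t}) : g ∈ invAltProds cs s t := by
  have mul_left {x : W} (hx : x ∈ ({cs.simple s, cs.simple t} : Set W)) {g : W}
      (hg : g ∈ invAltProds cs s t) : x * g ∈ invAltProds cs s t := by
    rcases hx with rfl | rfl
    · exact simple_mul_mem_invAltProds cs hpos hg
    · rw [orderOf_simple_mul_simple_comm] at hpos
      rw [invAltProds_comm] at hg ⊢
      exact simple_mul_mem_invAltProds cs hpos hg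
  induction hg using Subgroup.closure_induction_left with
  | one => exact ⟨0, Nat.zero_le _, by simp⟩
  | mul_left x hx g _ ih => exact mul_left hx ih
  | inv_mul_cancel x hx g _ ih =>
    have inv_eq : x⁻¹ = x := by rcases hx with rfl | rfl <;> exact cs.inv_simple _
    exact inv_eq.symm ▸ mul_left hx ih

end DihedralProducts

section StrongExchange

variable {B W : Type*} [Group W] {M : CoxeterMatrix B} (cs : CoxeterSystem M W)

open Classical in
/-- The action of `s_i` on pairs of a group element and a sign: conjugation by `s_i`, with a change
of sign at `s_i`. Along a word it counts, modulo 2, how often a reflection is inverted. -/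
noncomputable def signedConj (i : B) : Equiv.Perm (W × ZMod 2) :=
  Function.Involutive.toPerm
    (fun p => (cs.simple i * p.1 * cs.simple i, p.2 + if p.1 = cs.simple i then 1 else 0))
    fun ⟨t, ε⟩ => by
      have conj_eq_simple_iff : cs.simple i * t * cs.simple i = cs.simple i ↔ t = cs.simple i := by
        simp [mul_eq_one_iff_inv_eq, eq_comm]
      simp only [conj_eq_simple_iff, add_assoc, CharTwo.add_self_eq_zero, add_zero]
      simp [mul_assoc]

open Classical in
theorem signedConj_apply (i : B) (t : W) (ε : ZMod 2) :
    signedConj cs i (t, ε) =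
      (cs.simple i * t * cs.simple i, ε + if t = cs.simple i then 1 else 0) :=
  rfl

open Classical in
theorem prod_map_signedConj_apply (ω : List B) (t : W) (ε : ZMod 2) :
    (ω.map (signedConj cs)).prod (t, ε) =
      (cs.wordProd ω * t * (cs.wordProd ω)⁻¹, ε + (cs.rightInvSeq ω).count t) := by
  induction ω with
  | nil => simp
  | cons i ω ih =>
    have inverted_iff : cs.wordProd ω * t * (cs.wordProd ω)⁻¹ = cs.simple i ↔
        (cs.wordProd ω)⁻¹ * cs.simple i * cs.wordProd ω = t := by
      constructor <;> rintro h <;> simp [← h, mul_assoc]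
    rw [List.map_cons, List.prod_cons, Equiv.Perm.mul_apply, ih, signedConj_apply]
    simp only [inverted_iff, rightInvSeq, List.count_cons, beq_iff_eq]
    simp [wordProd_cons, mul_assoc, add_assoc]

theorem prod_map_alternatingWord_two_mul {N : Type*} [Monoid N] (f : B → N) (i j : B) (m : ℕ) :
    ((alternatingWord i j (2 * m)).map f).prod = (f i * f j) ^ m := by
  induction m with
  | zero => simp [alternatingWord]
  | succ m ih =>
    rw [Nat.mul_succ, alternatingWord_succ, alternatingWord_succ]
    simp [ih, pow_succ]

open Classical in
theorem even_count_rightInvSeq_alternatingWord (i j : B) (t : W) :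
    Even ((cs.rightInvSeq (alternatingWord i j (2 * M i j))).count t) := by
  have periodic (k : ℕ) : (cs.simple i * cs.simple j) ^ (M i j + k) =
      (cs.simple i * cs.simple j) ^ k := by
    rw [pow_add, cs.simple_mul_simple_pow, one_mul]
  rw [rightInvSeq_alternatingWord, List.map_reverse, List.count_reverse, two_mul, List.range_add,
    List.map_append, List.map_map, List.count_append]
  simp only [Function.comp_def, periodic]
  exact ⟨_, rfl⟩

theorem isLiftable_signedConj : M.IsLiftable (signedConj cs) := by
  classical
  intro i j
  ext1 ⟨t, ε⟩
  have even := even_count_rightInvSeq_alternatingWord cs i j t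
  rw [← prod_map_alternatingWord_two_mul, prod_map_signedConj_apply,
    (ZMod.natCast_eq_zero_iff_even).2 even, wordProd, prod_map_alternatingWord_two_mul,
    simple_mul_simple_pow]
  simp

/-- The action of the group on pairs of an element and a sign in which `s_i` acts by `signedConj`.
The sign of a pair `(t, ε)` changes under `w` exactly when `t` occurs an odd number of times
in the right inversion sequence of a word for `w`; that this parity depends only on `w` is the core
of the strong exchange property. -/
noncomputable def signedConjHom : W →* Equiv.Perm (W × ZMod 2) :=
  cs.lift ⟨signedConj cs, isLiftable_signedConj cs⟩

open Classical in
theorem signedConjHom_wordProd_apply (ω : List B) (t : W) (ε : ZMod 2) :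
    signedConjHom cs (cs.wordProd ω) (t, ε) =
      (cs.wordProd ω * t * (cs.wordProd ω)⁻¹, ε + (cs.rightInvSeq ω).count t) := by
  rw [← prod_map_signedConj_apply, wordProd, map_list_prod, List.map_map]
  congr! 4
  exact funext fun i => lift_apply_simple cs (isLiftable_signedConj cs) i

theorem signedConjHom_apply_add (w t : W) (ε δ : ZMod 2) :
    signedConjHom cs w (t, ε + δ) = ((signedConjHom cs w (t, ε)).1,
      (signedConjHom cs w (t, ε)).2 + δ) := by
  classical
  obtain ⟨ω, rfl⟩ := cs.wordProd_surjective w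
  simp [signedConjHom_wordProd_apply, add_right_comm]

theorem signedConjHom_reflection_apply {t : W} (ht : cs.IsReflection t) (ε : ZMod 2) :
    signedConjHom cs t (t, ε) = (t, ε + 1) := by
  classical
  obtain ⟨w, i, rfl⟩ := ht
  obtain ⟨δ, conj⟩ : ∃ δ, signedConjHom cs w⁻¹ (w * cs.simple i * w⁻¹, ε) = (cs.simple i, δ) := by
    obtain ⟨ω, hω⟩ := cs.wordProd_surjective w⁻¹
    rw [← hω, signedConjHom_wordProd_apply, hω]
    exact ⟨_, Prod.ext (by simp [mul_assoc]) rfl⟩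
  have conj_back : signedConjHom cs w (cs.simple i, δ) = (w * cs.simple i * w⁻¹, ε) := by
    rw [← conj, ← Equiv.Perm.mul_apply, ← map_mul, mul_inv_cancel, map_one, Equiv.Perm.one_apply]
  have simple : signedConjHom cs (cs.simple i) (cs.simple i, δ) = (cs.simple i, δ + 1) := by
    simpa using signedConjHom_wordProd_apply cs [i] (cs.simple i) δ
  rw [map_mul, map_mul, Equiv.Perm.mul_apply, Equiv.Perm.mul_apply, conj, simple,
    signedConjHom_apply_add, conj_back]

theorem mem_rightInvSeq_of_isRightInversion {ω : List B} {t : W}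
    (ht : cs.IsRightInversion (cs.wordProd ω) t) : t ∈ cs.rightInvSeq ω := by
  classical
  by_contra not_mem
  obtain ⟨ρ, hρ, hprod⟩ := cs.exists_isReduced (cs.wordProd ω * t)
  have not_mem' : t ∉ cs.rightInvSeq ρ := fun hmem => by
    have := (cs.isRightInversion_of_mem_rightInvSeq hρ hmem).2
    rw [← hprod, mul_assoc, ht.1.mul_self, mul_one] at this
    exact this.not_gt ht.2
  have sign := congrArg Prod.snd (signedConjHom_wordProd_apply cs ρ t 0)
  rw [← hprod, map_mul, Equiv.Perm.mul_apply, signedConjHom_reflection_apply cs ht.1,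
    signedConjHom_wordProd_apply, List.count_eq_zero.2 not_mem,
    List.count_eq_zero.2 not_mem'] at sign
  simp at sign

theorem mem_rightInvSeq_append (ω ω' : List B) (t : W) :
    t ∈ cs.rightInvSeq (ω ++ ω') ↔
      cs.wordProd ω' * t * (cs.wordProd ω')⁻¹ ∈ cs.rightInvSeq ω ∨ t ∈ cs.rightInvSeq ω' := by
  induction ω with
  | nil => simp
  | cons i ω ih =>
    have conj_iff : t = (cs.wordProd (ω ++ ω'))⁻¹ * cs.simple i * cs.wordProd (ω ++ ω') ↔
        cs.wordProd ω' * t * (cs.wordProd ω')⁻¹ =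
          (cs.wordProd ω)⁻¹ * cs.simple i * cs.wordProd ω := by
      rw [mul_inv_eq_iff_eq_mul, ← eq_inv_mul_iff_mul_eq, wordProd_append]
      simp only [mul_inv_rev, mul_assoc]
    rw [List.cons_append, rightInvSeq, rightInvSeq, List.mem_cons, List.mem_cons, ih, conj_iff,
      or_assoc]

end StrongExchange

section DihedralCosets

variable {B W : Type*} [Group W] {M : CoxeterMatrix B} (cs : CoxeterSystem M W)

/-- `u` has minimal length in its coset of the dihedral subgroup generated by `s` and `t`. -/
def IsShortestInCoset (s t : B) (u : W) : Prop :=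
  ∀ g ∈ Subgroup.closure {cs.simple s, cs.simple t}, cs.length u ≤ cs.length (g * u)

theorem exists_isShortestInCoset_mul (s t : B) (x : W) :
    ∃ g ∈ Subgroup.closure {cs.simple s, cs.simple t}, IsShortestInCoset cs s t (g * x) := by
  obtain ⟨g, hg, hmin⟩ := exists_minimalFor_of_wellFoundedLT
    (· ∈ Subgroup.closure {cs.simple s, cs.simple t}) (fun g => cs.length (g * x)) ⟨1, one_mem _⟩
  refine ⟨g, hg, fun h hh => le_of_not_gt fun hlt => hlt.not_ge ?_⟩
  rw [← mul_assoc] at hlt ⊢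
  exact hmin (mul_mem hh hg) hlt.le

theorem exists_isShortestInCoset_eq_inv_altProd_mul {s t : B}
    (hpos : 0 < orderOf (cs.simple s * cs.simple t)) (x : W) :
    ∃ u, IsShortestInCoset cs s t u ∧ ∃ k ≤ orderOf (cs.simple s * cs.simple t),
      x = (altProd cs s t k)⁻¹ * u ∨ x = (altProd cs t s k)⁻¹ * u := by
  obtain ⟨g, hg, hmin⟩ := exists_isShortestInCoset_mul cs s t x
  obtain ⟨k, hk, h⟩ := mem_invAltProds_of_mem_closure cs hpos (inv_mem hg)
  refine ⟨g * x, hmin, k, hk, h.imp ?_ ?_⟩ <;> exact fun h => by rw [← h, inv_mul_cancel_left]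

variable {cs}

theorem IsShortestInCoset.symm {s t : B} {u : W} (hu : IsShortestInCoset cs s t u) :
    IsShortestInCoset cs t s u := by
  rwa [IsShortestInCoset, Set.pair_comm]

theorem IsShortestInCoset.not_isLeftDescent {s t : B} {u : W} (hu : IsShortestInCoset cs s t u)
    {k : ℕ} (hk : k < orderOf (cs.simple s * cs.simple t)) :
    ¬cs.IsLeftDescent ((altProd cs s t k)⁻¹ * u) s := by
  obtain ⟨ρ, hρ, hprod⟩ := cs.exists_isReduced u⁻¹
  rw [← isRightDescent_inv_iff, ← isRightInversion_simple_iff_isRightDescent, mul_inv_rev, inv_inv,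
    hprod, altProd, ← wordProd_append]
  intro inverted
  rcases (mem_rightInvSeq_append cs _ _ _).1 (mem_rightInvSeq_of_isRightInversion cs inverted) with
    hmem | hmem
  · have inversion := cs.isRightInversion_of_mem_rightInvSeq hρ hmem
    have shorter := inversion.2
    rw [← hprod, ← inversion.1.inv, ← mul_inv_rev, length_inv, length_inv] at shorter
    have alt_mem := altProd_mem_closure cs s t k
    exact (hu _ (mul_mem (mul_mem alt_mem (Subgroup.subset_closure (by simp)))
      (inv_mem alt_mem))).not_gt shorter
  · rw [rightInvSeq_alternatingWord, List.mem_map] at hmem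
    obtain ⟨j, hj, hs⟩ := hmem
    refine pow_ne_one_of_lt_orderOf j.succ_ne_zero ?_ (x := cs.simple s * cs.simple t) ?_
    · simp only [List.mem_reverse, List.mem_range] at hj
      omega
    · rw [pow_succ', mul_assoc, hs, simple_mul_simple_self]

theorem IsShortestInCoset.length_inv_altProd_mul {s t : B} {u : W}
    (hu : IsShortestInCoset cs s t u) {k : ℕ} (hk : k ≤ orderOf (cs.simple s * cs.simple t)) :
    cs.length ((altProd cs s t k)⁻¹ * u) = cs.length u + k := by
  induction k generalizing s t with
  | zero => simp
  | succ k ih =>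
    rw [orderOf_simple_mul_simple_comm] at hk
    rw [inv_altProd_succ, mul_assoc, cs.not_isLeftDescent_iff.1 (hu.symm.not_isLeftDescent hk),
      ih hu.symm (Nat.le_of_succ_le hk), add_assoc]

theorem altProd_succ_mul_inv_altProd (s t : B) (p k : ℕ) :
    altProd cs t s (p + 1) * (altProd cs s t k)⁻¹ =
      altProd cs s t p * (altProd cs t s (k + 1))⁻¹ := by
  rw [altProd_succ, inv_altProd_succ, mul_assoc]

theorem altProd_mul_inv_altProd_of_add_eq_orderOf {s t : B} {p k : ℕ}
    (h : k + p = orderOf (cs.simple s * cs.simple t)) :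
    altProd cs t s p * (altProd cs s t k)⁻¹ =
      (altProd cs s t (orderOf (cs.simple s * cs.simple t)))⁻¹ := by
  induction p generalizing s t k with
  | zero => rw [altProd_zero, one_mul, ← h, add_zero]
  | succ p ih =>
    rw [orderOf_simple_mul_simple_comm] at h
    rw [altProd_succ_mul_inv_altProd, ih (by omega), altProd_orderOf_swap,
      orderOf_simple_mul_simple_comm]

variable (cs) in
/-- Multiplying `x` on the left by the `p` letters of `altProd s t p`, one after the other, makes
it longer at each step. -/
def IsAscendingChain (s t : B) (p : ℕ) (x : W) : Prop :=
  ∀ i ≤ p, cs.length (altProd cs s t i * x) = cs.length x + i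

theorem IsAscendingChain.not_isLeftDescent {s t : B} {p : ℕ} {x : W}
    (h : IsAscendingChain cs s t (p + 1) x) : ¬cs.IsLeftDescent x t :=
  cs.not_isLeftDescent_iff.2 (by simpa [altProd_succ] using h 1 (by omega))

theorem IsAscendingChain.tail {s t : B} {p : ℕ} {x : W}
    (h : IsAscendingChain cs s t (p + 1) x) : IsAscendingChain cs t s p (cs.simple t * x) :=
  fun i hi => by
    rw [cs.not_isLeftDescent_iff.1 h.not_isLeftDescent, ← mul_assoc, ← altProd_succ,
      h (i + 1) (by omega)]
    omega

theorem IsShortestInCoset.isAscendingChain {s t : B} {u : W} (hu : IsShortestInCoset cs s t u)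
    {p k : ℕ} (h : k + p ≤ orderOf (cs.simple s * cs.simple t)) :
    IsAscendingChain cs t s p ((altProd cs s t k)⁻¹ * u) := by
  intro i hi
  have length_eq (i : ℕ) : k + i ≤ orderOf (cs.simple s * cs.simple t) →
      cs.length (altProd cs t s i * ((altProd cs s t k)⁻¹ * u)) = cs.length u + (k + i) := by
    clear h
    induction i generalizing s t k with
    | zero => simpa using hu.length_inv_altProd_mul
    | succ i ih =>
      intro h
      rw [orderOf_simple_mul_simple_comm] at h
      rw [← mul_assoc, altProd_succ_mul_inv_altProd, mul_assoc, ih hu.symm (by omega)]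
      omega
  rw [length_eq i (by omega), hu.length_inv_altProd_mul (by omega), add_assoc]

theorem IsShortestInCoset.isAscendingChain_self {s t : B} {u : W}
    (hu : IsShortestInCoset cs s t u) :
    IsAscendingChain cs s t (orderOf (cs.simple s * cs.simple t)) u := by
  simpa [orderOf_simple_mul_simple_comm cs s t] using hu.symm.isAscendingChain (zero_add _).le

theorem IsShortestInCoset.isLeftDescent_top {s t : B} {u : W} (hu : IsShortestInCoset cs s t u)
    (hpos : 0 < orderOf (cs.simple s * cs.simple t)) :
    cs.IsLeftDescent ((altProd cs s t (orderOf (cs.simple s * cs.simple t)))⁻¹ * u) t := by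
  obtain ⟨l, hl⟩ := Nat.exists_eq_add_one.2 hpos
  have ascent : ¬cs.IsLeftDescent ((altProd cs t s l)⁻¹ * u) t :=
    hu.symm.not_isLeftDescent (by rw [orderOf_simple_mul_simple_comm]; omega)
  rw [hl, inv_altProd_succ, mul_assoc, isLeftDescent_iff_not_isLeftDescent_mul,
    simple_mul_simple_cancel_left]
  exact ascent

end DihedralCosets

section BasisVec

open Classical in
/-- The basis vector of `ℂX` at `w`, extended by zero to all `w ∉ X`. -/
noncomputable def basisVec {W : Type*} (X : Set W) (w : W) : X →₀ ℂ :=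
  if h : w ∈ X then Finsupp.single ⟨w, h⟩ 1 else 0

variable {W : Type*} {X : Set W}

theorem single_one_eq_basisVec (x : X) : Finsupp.single x 1 = basisVec X (x : W) := by
  rw [basisVec, dif_pos x.2]

theorem basisVec_of_notMem {w : W} (hw : w ∉ X) : basisVec X w = 0 := dif_neg hw

end BasisVec

section AscentOperators

variable {B W : Type} [Group W] {M : CoxeterMatrix B} (cs : CoxeterSystem M W) {X : Set W}

theorem piOp_basisVec_of_isLeftDescent {s : B} {w : W} (hs : cs.IsLeftDescent w s) :
    piOp cs X s (basisVec X w) = -basisVec X w := by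
  by_cases hw : w ∈ X
  · rw [← single_one_eq_basisVec ⟨w, hw⟩, piOp, Finsupp.linearCombination_single, one_smul]
    exact if_pos hs
  · rw [basisVec_of_notMem hw, map_zero, neg_zero]

open Classical in
theorem piOp_basisVec_of_not_isLeftDescent {s : B} {w : W} (hs : ¬cs.IsLeftDescent w s) :
    piOp cs X s (basisVec X w) = if w ∈ X then basisVec X (cs.simple s * w) else 0 := by
  by_cases hw : w ∈ X
  · rw [if_pos hw, ← single_one_eq_basisVec ⟨w, hw⟩, piOp, Finsupp.linearCombination_single,
      one_smul]
    exact if_neg hs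
  · rw [if_neg hw, basisVec_of_notMem hw, map_zero]

variable (X)

theorem piOp_mul_self (s : B) : piOp cs X s * piOp cs X s = -piOp cs X s := by
  refine Finsupp.lhom_ext' fun x => LinearMap.ext_ring ?_
  simp only [LinearMap.comp_apply, Finsupp.lsingle_apply, Module.End.mul_apply,
    LinearMap.neg_apply, single_one_eq_basisVec]
  by_cases hs : cs.IsLeftDescent (x : W) s
  · simp only [piOp_basisVec_of_isLeftDescent cs hs, map_neg]
  · rw [piOp_basisVec_of_not_isLeftDescent cs hs, if_pos x.2, piOp_basisVec_of_isLeftDescent]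
    rwa [isLeftDescent_iff_not_isLeftDescent_mul, simple_mul_simple_cancel_left]

/-- The alternating product `⋯ π_s π_t π_s π_t` of `k` of the operators on `ℂX`, the last of which
is `π_t`. -/
noncomputable def piAlternating (s t : B) (k : ℕ) : Module.End ℂ (X →₀ ℂ) :=
  ((alternatingWord s t k).map (piOp cs X)).prod

theorem piAlternating_zero (s t : B) : piAlternating cs X s t 0 = 1 := by
  simp [piAlternating, alternatingWord]

theorem piAlternating_succ_apply (s t : B) (k : ℕ) (v : X →₀ ℂ) :
    piAlternating cs X s t (k + 1) v = piAlternating cs X t s k (piOp cs X t v) := by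
  simp [piAlternating, alternatingWord_succ]

variable {X}

theorem piAlternating_basisVec_of_isLeftDescent {s t : B} {w : W} (hs : cs.IsLeftDescent w s)
    (ht : cs.IsLeftDescent w t) (k : ℕ) :
    piAlternating cs X s t k (basisVec X w) = (-1 : ℂ) ^ k • basisVec X w := by
  induction k generalizing s t with
  | zero => simp [piAlternating_zero]
  | succ k ih =>
    rw [piAlternating_succ_apply, piOp_basisVec_of_isLeftDescent cs ht, map_neg, ih ht hs, pow_succ]
    simp

open Classical in
theorem piAlternating_basisVec_of_isAscendingChain {s t : B} {p : ℕ} {x : W}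
    (hx : IsAscendingChain cs s t p x) (hs : cs.IsLeftDescent (altProd cs s t p * x) s)
    (ht : cs.IsLeftDescent (altProd cs s t p * x) t) (q : ℕ) :
    piAlternating cs X s t (p + q) (basisVec X x) =
      if ∀ i ≤ p, altProd cs s t i * x ∈ X then (-1 : ℂ) ^ q • basisVec X (altProd cs s t p * x)
      else 0 := by
  induction p generalizing s t x with
  | zero =>
    simp only [altProd_zero, one_mul] at hs ht
    rw [zero_add, piAlternating_basisVec_of_isLeftDescent cs hs ht]
    by_cases hw : x ∈ X <;> simp [hw, basisVec_of_notMem]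
  | succ p ih =>
    rw [altProd_succ, mul_assoc] at hs ht
    have forall_le_succ_iff : (∀ i ≤ p + 1, altProd cs s t i * x ∈ X) ↔
        x ∈ X ∧ ∀ i ≤ p, altProd cs t s i * (cs.simple t * x) ∈ X := by
      simp only [← Nat.lt_succ_iff, Nat.forall_lt_succ_left, altProd_zero, one_mul, altProd_succ,
        mul_assoc]
    rw [Nat.add_right_comm, piAlternating_succ_apply,
      piOp_basisVec_of_not_isLeftDescent cs hx.not_isLeftDescent,
      apply_ite (piAlternating cs X t s (p + q)), map_zero, ih hx.tail ht hs, ← ite_and,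
      altProd_succ, mul_assoc]
    simp only [forall_le_succ_iff]

theorem IsAscendingChain.not_isLeftDescent_of_altProd_succ {s t r : B} {p i : ℕ} {x : W}
    (hx : IsAscendingChain cs s t p x) (hi : i < p)
    (hr : altProd cs s t (i + 1) = cs.simple r * altProd cs s t i) :
    ¬cs.IsLeftDescent (altProd cs s t i * x) r := by
  rw [not_isLeftDescent_iff, ← mul_assoc, ← hr, hx _ hi, hx _ hi.le, add_assoc]

theorem IsShortestInCoset.exists_aligned_of_add_eq_orderOf {s t : B} {u : W}
    (hu : IsShortestInCoset cs s t u) {k l : ℕ}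
    (h : k + l + 1 = orderOf (cs.simple s * cs.simple t)) :
    ∃ r r', Aligned cs (altProd cs s t k * u) (altProd cs t s l * u) r r' ∧
      altProd cs s t (k + 1) = cs.simple r * altProd cs s t k ∧
      altProd cs t s (l + 1) = cs.simple r' * altProd cs t s l := by
  obtain ⟨r, hr⟩ := exists_altProd_succ_eq_simple_mul cs s t k
  obtain ⟨r', hr'⟩ := exists_altProd_succ_eq_simple_mul cs t s l
  have reflection {a b c : B} {i : ℕ}
      (hc : altProd cs a b (i + 1) = cs.simple c * altProd cs a b i) :
      (altProd cs a b i * u)⁻¹ * cs.simple c * (altProd cs a b i * u) =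
        u⁻¹ * (cs.simple b * (cs.simple a * cs.simple b) ^ i) * u := by
    rw [← inv_altProd_mul_altProd_succ, hc]
    simp only [mul_inv_rev, mul_assoc]
  refine ⟨r, r', ⟨?_, ?_, ?_⟩, hr, hr'⟩
  · exact hu.isAscendingChain_self.not_isLeftDescent_of_altProd_succ cs (by omega) hr
  · refine hu.symm.isAscendingChain_self.not_isLeftDescent_of_altProd_succ cs ?_ hr'
    rw [orderOf_simple_mul_simple_comm]
    omega
  · rw [reflection hr, reflection hr', simple_mul_pow_eq_of_add_eq_orderOf cs h]

theorem AscentCompatible.altProd_mul_mem_swap (hX : AscentCompatible cs X) {s t : B} {u : W}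
    (hu : IsShortestInCoset cs s t u)
    (hmem : ∀ i ≤ orderOf (cs.simple s * cs.simple t), altProd cs s t i * u ∈ X) :
    ∀ i ≤ orderOf (cs.simple s * cs.simple t), altProd cs t s i * u ∈ X := by
  intro i hi
  induction i with
  | zero => simpa using hmem 0 hi
  | succ i ih =>
    obtain ⟨l, hl⟩ : ∃ l, l + i + 1 = orderOf (cs.simple s * cs.simple t) :=
      ⟨_, by rw [add_assoc]; exact Nat.sub_add_cancel hi⟩
    obtain ⟨r, r', aligned, hr, hr'⟩ := hu.exists_aligned_of_add_eq_orderOf cs hl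
    rw [hr', mul_assoc, ← hX _ (hmem l (by omega)) _ (ih (by omega)) r r' aligned,
      ← mul_assoc, ← hr]
    exact hmem _ (by omega)

theorem AscentCompatible.forall_altProd_mul_mem_iff (hX : AscentCompatible cs X) {s t : B} {u : W}
    (hu : IsShortestInCoset cs s t u) :
    (∀ i ≤ orderOf (cs.simple s * cs.simple t), altProd cs s t i * u ∈ X) ↔
      ∀ i ≤ orderOf (cs.simple s * cs.simple t), altProd cs t s i * u ∈ X := by
  refine ⟨hX.altProd_mul_mem_swap cs hu, ?_⟩
  rw [orderOf_simple_mul_simple_comm]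
  exact hX.altProd_mul_mem_swap cs hu.symm

open Classical in
theorem IsShortestInCoset.piAlternating_basisVec {s t : B} {u : W}
    (hu : IsShortestInCoset cs s t u) (hpos : 0 < orderOf (cs.simple s * cs.simple t)) {k p : ℕ}
    (h : k + p = orderOf (cs.simple s * cs.simple t)) (q : ℕ) :
    piAlternating cs X t s (p + q) (basisVec X ((altProd cs s t k)⁻¹ * u)) =
      if ∀ i ≤ p, altProd cs t s i * ((altProd cs s t k)⁻¹ * u) ∈ X then
        (-1 : ℂ) ^ q •
          basisVec X ((altProd cs s t (orderOf (cs.simple s * cs.simple t)))⁻¹ * u)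
      else 0 := by
  have top_eq : altProd cs t s p * ((altProd cs s t k)⁻¹ * u) =
      (altProd cs s t (orderOf (cs.simple s * cs.simple t)))⁻¹ * u := by
    rw [← mul_assoc, altProd_mul_inv_altProd_of_add_eq_orderOf h]
  have descent_t : cs.IsLeftDescent (altProd cs t s p * ((altProd cs s t k)⁻¹ * u)) t :=
    top_eq ▸ hu.isLeftDescent_top hpos
  have descent_s : cs.IsLeftDescent (altProd cs t s p * ((altProd cs s t k)⁻¹ * u)) s := by
    rw [top_eq, altProd_orderOf_swap, orderOf_simple_mul_simple_comm]
    exact hu.symm.isLeftDescent_top (by rwa [orderOf_simple_mul_simple_comm])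
  rw [piAlternating_basisVec_of_isAscendingChain cs (hu.isAscendingChain h.le) descent_t descent_s,
    top_eq]

theorem AscentCompatible.piAlternating_basisVec_swap (hX : AscentCompatible cs X) {s t : B} {u : W}
    (hu : IsShortestInCoset cs s t u) {N : ℕ} (hpos : 0 < orderOf (cs.simple s * cs.simple t))
    (hN : orderOf (cs.simple s * cs.simple t) ≤ N) :
    piAlternating cs X s t N (basisVec X u) = piAlternating cs X t s N (basisVec X u) := by
  classical
  obtain ⟨q, rfl⟩ := Nat.exists_eq_add_of_le hN
  have climb := hu.piAlternating_basisVec (X := X) cs hpos (zero_add _) q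
  have climb_symm := hu.symm.piAlternating_basisVec (X := X) cs
    (by rwa [orderOf_simple_mul_simple_comm]) (zero_add _) q
  simp only [altProd_zero, inv_one, one_mul, orderOf_simple_mul_simple_comm cs t s]
    at climb climb_symm
  rw [climb, climb_symm, altProd_orderOf_swap]
  simp only [hX.forall_altProd_mul_mem_iff cs hu]

theorem IsShortestInCoset.piAlternating_basisVec_swap_of_pos {s t : B} {u : W}
    (hu : IsShortestInCoset cs s t u) {k N : ℕ} (hk : k + 1 ≤ orderOf (cs.simple s * cs.simple t))
    (hN : orderOf (cs.simple s * cs.simple t) ≤ N) :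
    piAlternating cs X s t N (basisVec X ((altProd cs s t (k + 1))⁻¹ * u)) =
      piAlternating cs X t s N (basisVec X ((altProd cs s t (k + 1))⁻¹ * u)) := by
  classical
  obtain ⟨p, hp⟩ := Nat.exists_eq_add_of_le hk
  obtain ⟨q, rfl⟩ : ∃ q, N = p + q + 1 := ⟨N - 1 - p, by omega⟩
  have descent : cs.IsLeftDescent ((altProd cs s t (k + 1))⁻¹ * u) t := by
    rw [inv_altProd_succ, mul_assoc, isLeftDescent_iff_not_isLeftDescent_mul,
      simple_mul_simple_cancel_left]
    exact hu.symm.not_isLeftDescent (by rwa [orderOf_simple_mul_simple_comm])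
  rw [piAlternating_succ_apply, piOp_basisVec_of_isLeftDescent cs descent, map_neg,
    hu.piAlternating_basisVec cs (by omega) hp.symm, add_assoc p q,
    hu.piAlternating_basisVec cs (by omega) hp.symm, pow_succ]
  split_ifs <;> simp

theorem AscentCompatible.piAlternating_inv_altProd_swap (hX : AscentCompatible cs X) {s t : B}
    {u : W} (hu : IsShortestInCoset cs s t u) {k N : ℕ}
    (hpos : 0 < orderOf (cs.simple s * cs.simple t))
    (hk : k ≤ orderOf (cs.simple s * cs.simple t)) (hN : orderOf (cs.simple s * cs.simple t) ≤ N) :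
    piAlternating cs X s t N (basisVec X ((altProd cs s t k)⁻¹ * u)) =
      piAlternating cs X t s N (basisVec X ((altProd cs s t k)⁻¹ * u)) := by
  cases k with
  | zero => simpa using hX.piAlternating_basisVec_swap cs hu hpos hN
  | succ k => exact hu.piAlternating_basisVec_swap_of_pos cs hk hN

theorem AscentCompatible.piAlternating_swap (hX : AscentCompatible cs X) {s t : B} {N : ℕ}
    (hpos : 0 < orderOf (cs.simple s * cs.simple t))
    (hN : orderOf (cs.simple s * cs.simple t) ≤ N) :
    piAlternating cs X s t N = piAlternating cs X t s N := by
  refine Finsupp.lhom_ext' fun x => LinearMap.ext_ring ?_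
  rw [LinearMap.comp_apply, LinearMap.comp_apply, Finsupp.lsingle_apply, single_one_eq_basisVec]
  obtain ⟨u, hu, k, hk, hx | hx⟩ := exists_isShortestInCoset_eq_inv_altProd_mul cs hpos (x : W)
  · rw [hx, hX.piAlternating_inv_altProd_swap cs hu hpos hk hN]
  · rw [orderOf_simple_mul_simple_comm] at hpos hk hN
    rw [hx, hX.piAlternating_inv_altProd_swap cs hu.symm hpos hk hN]

/-- The representation of the 0-Hecke algebra on `ℂX` defined by an ascent-compatible set `X`. -/
noncomputable def ascentRep (hX : AscentCompatible cs X) :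
    ZeroHecke M →ₐ[ℂ] Module.End ℂ (X →₀ ℂ) :=
  ZeroHecke.lift (piOp cs X) (piOp_mul_self cs X) fun s t _ hM => by
    have dvd : orderOf (cs.simple s * cs.simple t) ∣ M s t :=
      orderOf_dvd_of_pow_eq_one (cs.simple_mul_simple_pow s t)
    exact hX.piAlternating_swap cs (Nat.pos_of_dvd_of_pos dvd (Nat.pos_of_ne_zero hM))
        (Nat.le_of_dvd (Nat.pos_of_ne_zero hM) dvd)

theorem ascentRep_gen (hX : AscentCompatible cs X) (s : B) :
    ascentRep cs hX (ZeroHecke.gen M s) = piOp cs X s :=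
  ZeroHecke.lift_gen ..

end AscentOperators

section Triangular

/-- The operator `f` on the free module over `ι` is triangular with respect to the height `ℓ`, with
diagonal `χ`: it acts as `χ i` on the coefficient at `i` of a vector supported at heights at least
`ℓ i`. -/
def IsTriangular {ι α R : Type*} [CommSemiring R] [LE α] (ℓ : ι → α) (χ : ι → R)
    (f : Module.End R (ι →₀ R)) : Prop :=
  ∀ (v : ι →₀ R) (i : ι), (∀ j, v j ≠ 0 → ℓ i ≤ ℓ j) → f v i = χ i * v i

variable {ι α R : Type*} [CommSemiring R] {ℓ : ι → α} {χ ψ : ι → R} {f g : Module.End R (ι →₀ R)}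

section LE

variable [LE α]

theorem IsTriangular.of_single
    (h : ∀ i j, ℓ i ≤ ℓ j → f (Finsupp.single j 1) i = Finsupp.single j (χ j) i) :
    IsTriangular ℓ χ f := by
  intro v i hv
  have term (j : ι) (hj : j ∈ v.support) :
      f (Finsupp.single j (v j)) i = χ i * Finsupp.single j (v j) i := by
    rw [← mul_one (v j), ← smul_eq_mul, ← Finsupp.smul_single, map_smul, Finsupp.smul_apply,
      h i j (hv j (Finsupp.mem_support_iff.1 hj))]
    rcases eq_or_ne j i with rfl | hji
    · simp [mul_comm]
    · simp [Finsupp.single_eq_of_ne' hji]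
  have coeff : v.sum Finsupp.single i = ∑ j ∈ v.support, Finsupp.single j (v j) i :=
    Finsupp.finsetSum_apply ..
  calc f v i = f (v.sum Finsupp.single) i := by rw [v.sum_single]
    _ = ∑ j ∈ v.support, f (Finsupp.single j (v j)) i := by
      rw [Finsupp.sum, map_sum, Finsupp.finsetSum_apply]
    _ = χ i * v i := by
      rw [Finset.sum_congr rfl term, ← Finset.mul_sum, ← coeff, v.sum_single]

theorem IsTriangular.algebraMap (c : R) :
    IsTriangular ℓ (fun _ => c) (algebraMap R (Module.End R (ι →₀ R)) c) :=
  fun v i _ => by simp [Module.algebraMap_end_apply]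

theorem IsTriangular.add (hf : IsTriangular ℓ χ f) (hg : IsTriangular ℓ ψ g) :
    IsTriangular ℓ (χ + ψ) (f + g) :=
  fun v i hv => by simp [hf v i hv, hg v i hv, add_mul]

theorem IsTriangular.supported_mem_invtSubmodule (hf : IsTriangular ℓ χ f) {i : ι} {S : Set ι}
    (hi : i ∉ S) (hmin : ∀ j ∈ S, ℓ i ≤ ℓ j)
    (hinsert : Finsupp.supported R R (insert i S) ∈ f.invtSubmodule) :
    Finsupp.supported R R S ∈ f.invtSubmodule := by
  intro v hv j hj
  have hvS (k : ι) (hk : v k ≠ 0) : k ∈ S := hv (Finsupp.mem_support_iff.2 hk)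
  refine (hinsert (Finsupp.supported_mono (Set.subset_insert i S) hv) hj).resolve_left ?_
  rintro rfl
  refine Finsupp.mem_support_iff.1 hj ?_
  rw [hf v j fun k hk => hmin k (hvS k hk), by_contra fun h => hi (hvS j h), mul_zero]

end LE

theorem IsTriangular.mul [LinearOrder α] (hf : IsTriangular ℓ χ f) (hg : IsTriangular ℓ ψ g) :
    IsTriangular ℓ (χ * ψ) (f * g) := by
  intro v i hv
  have support_le (j : ι) (hj : g v j ≠ 0) : ℓ i ≤ ℓ j := by
    by_contra! hlt
    rw [hg v j fun k hk => hlt.le.trans (hv k hk)] at hj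
    exact hlt.not_ge (hv j (right_ne_zero_of_mul hj))
  rw [Module.End.mul_apply, hf _ i support_le, hg v i hv, Pi.mul_apply, mul_assoc]

end Triangular

section GrothendieckClass

variable {A : Type} [Ring A] [Algebra ℂ A]

theorem G0.mk_eq_zero {R : Type} [Ring R] (V : FGModuleCat.{0} R) [Subsingleton V] :
    G0.mk V = 0 := by
  have := G0.mk_eq (LinearMap.id : V →ₗ[R] V) (0 : V →ₗ[R] V) Function.injective_id
    (fun x => ⟨fun _ => ⟨x, rfl⟩, fun _ => rfl⟩) (fun x => ⟨x, Subsingleton.elim _ _⟩)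
  exact left_eq_add.1 this

variable {U V V' : Type} [AddCommGroup U] [Module ℂ U] [AddCommGroup V] [Module ℂ V]
  [AddCommGroup V'] [Module ℂ V']

theorem G0.mk_moduleOfRep_of_exact {σ : A →ₐ[ℂ] Module.End ℂ U} {ρ : A →ₐ[ℂ] Module.End ℂ V}
    {τ : A →ₐ[ℂ] Module.End ℂ V'} (hU : Module.Finite ℂ U) (hV : Module.Finite ℂ V)
    (hV' : Module.Finite ℂ V') (f : U →ₗ[ℂ] V) (g : V →ₗ[ℂ] V')
    (hf : Function.Injective f) (hfg : Function.Exact f g) (hg : Function.Surjective g)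
    (map_f : ∀ a x, f (σ a x) = ρ a (f x)) (map_g : ∀ a x, g (ρ a x) = τ a (g x)) :
    G0.mk (moduleOfRep ρ hV) = G0.mk (moduleOfRep σ hU) + G0.mk (moduleOfRep τ hV') :=
  let f' : moduleOfRep σ hU →ₗ[A] moduleOfRep ρ hV := { f with map_smul' := map_f }
  let g' : moduleOfRep ρ hV →ₗ[A] moduleOfRep τ hV' := { g with map_smul' := map_g }
  G0.mk_eq f' g' hf hfg hg

theorem G0.mk_moduleOfRep_of_bijective {σ : A →ₐ[ℂ] Module.End ℂ U} {ρ : A →ₐ[ℂ] Module.End ℂ V}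
    (hU : Module.Finite ℂ U) (hV : Module.Finite ℂ V) (f : U →ₗ[ℂ] V)
    (hf : Function.Bijective f) (map_f : ∀ a x, f (σ a x) = ρ a (f x)) :
    G0.mk (moduleOfRep ρ hV) = G0.mk (moduleOfRep σ hU) := by
  let f' : moduleOfRep σ hU →ₗ[A] moduleOfRep ρ hV := { f with map_smul' := map_f }
  let zero : FGModuleCat.{0} A := FGModuleCat.of A PUnit
  have : Subsingleton zero := inferInstanceAs (Subsingleton PUnit)
  rw [G0.mk_eq (C := zero) f' 0 hf.1 (fun y => ⟨fun _ => hf.2 y, fun _ => rfl⟩)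
    (fun x => ⟨0, Subsingleton.elim _ _⟩), G0.mk_eq_zero zero, add_zero]

/-- The restriction of a representation to an invariant subspace. -/
def restrictRep (ρ : A →ₐ[ℂ] Module.End ℂ V) (N : Submodule ℂ V)
    (hN : ∀ a, N ∈ (ρ a).invtSubmodule) : A →ₐ[ℂ] Module.End ℂ N where
  toFun a := (ρ a).restrict (hN a)
  map_one' := LinearMap.ext fun x => Subtype.ext (LinearMap.congr_fun (map_one ρ) x)
  map_mul' a b := LinearMap.ext fun x => Subtype.ext (LinearMap.congr_fun (map_mul ρ a b) x)
  map_zero' := LinearMap.ext fun x => Subtype.ext (LinearMap.congr_fun (map_zero ρ) x)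
  map_add' a b := LinearMap.ext fun x => Subtype.ext (LinearMap.congr_fun (map_add ρ a b) x)
  commutes' c := LinearMap.ext fun x => Subtype.ext (LinearMap.congr_fun (ρ.commutes c) x)

theorem G0.mk_restrictRep_supported_insert {ι α : Type} [Finite ι] [LinearOrder α] {ℓ : ι → α}
    {χ : ι → A →ₐ[ℂ] ℂ} {ρ : A →ₐ[ℂ] Module.End ℂ (ι →₀ ℂ)}
    (hρ : ∀ a, IsTriangular ℓ (fun i => χ i a) (ρ a)) {i : ι} {S : Set ι} (hi : i ∉ S)
    (hmin : ∀ j ∈ S, ℓ i ≤ ℓ j) (hS : ∀ a, Finsupp.supported ℂ ℂ S ∈ (ρ a).invtSubmodule)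
    (hinsert : ∀ a, Finsupp.supported ℂ ℂ (insert i S) ∈ (ρ a).invtSubmodule) :
    G0.mk (moduleOfRep (V := Finsupp.supported ℂ ℂ (insert i S)) (restrictRep ρ _ hinsert)
        inferInstance) =
      G0.mk (moduleOfRep (V := Finsupp.supported ℂ ℂ S) (restrictRep ρ _ hS) inferInstance) +
        G0.mk (moduleOfRep ((Algebra.lmul ℂ ℂ).comp (χ i)) inferInstance) := by
  have supported_le := Finsupp.supported_mono (M := ℂ) (R := ℂ) (Set.subset_insert i S)
  refine G0.mk_moduleOfRep_of_exact _ _ _ (Submodule.inclusion supported_le)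
    (Finsupp.lapply i ∘ₗ (Finsupp.supported ℂ ℂ (insert i S)).subtype)
    (Submodule.inclusion_injective _) (fun v => ⟨fun hv => ?_, ?_⟩) (fun c => ?_)
    (fun a v => rfl) (fun a v => ?_)
  · refine ⟨⟨v, fun j hj => (v.2 hj).resolve_left ?_⟩, rfl⟩
    rintro rfl
    exact Finsupp.mem_support_iff.1 hj hv
  · rintro ⟨w, rfl⟩
    exact by_contra fun h => hi (w.2 (Finsupp.mem_support_iff.2 h))
  · exact ⟨⟨_, Finsupp.single_mem_supported ℂ c (Set.mem_insert i S)⟩, Finsupp.single_eq_same⟩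
  · refine hρ a v i fun j hj => ?_
    rcases v.2 (Finsupp.mem_support_iff.2 hj) with rfl | hjS
    exacts [le_rfl, hmin j hjS]

theorem G0.mk_restrictRep_supported {ι α : Type} [Finite ι] [LinearOrder α] {ℓ : ι → α}
    {χ : ι → A →ₐ[ℂ] ℂ} {ρ : A →ₐ[ℂ] Module.End ℂ (ι →₀ ℂ)}
    (hρ : ∀ a, IsTriangular ℓ (fun i => χ i a) (ρ a)) (S : Finset ι)
    (hS : ∀ a, Finsupp.supported ℂ ℂ (S : Set ι) ∈ (ρ a).invtSubmodule) :
    G0.mk (moduleOfRep (V := Finsupp.supported ℂ ℂ (S : Set ι)) (restrictRep ρ _ hS)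
        inferInstance) =
      ∑ i ∈ S, G0.mk (moduleOfRep ((Algebra.lmul ℂ ℂ).comp (χ i)) inferInstance) := by
  classical
  induction S using Finset.induction_on_min_value ℓ with
  | empty =>
    have : Subsingleton (Finsupp.supported ℂ ℂ ((∅ : Finset ι) : Set ι)) := by
      rw [Finset.coe_empty, Finsupp.supported_empty]
      infer_instance
    have : Subsingleton (moduleOfRep (V := Finsupp.supported ℂ ℂ ((∅ : Finset ι) : Set ι))
      (restrictRep ρ _ hS) inferInstance) := this
    rw [G0.mk_eq_zero, Finset.sum_empty]
  | insert i S hi hmin ih =>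
    revert hS
    rw [Finset.coe_insert]
    intro hS
    have hS' (a : A) := (hρ a).supported_mem_invtSubmodule hi hmin (hS a)
    rw [Finset.sum_insert hi, ← ih hS', add_comm,
      G0.mk_restrictRep_supported_insert hρ hi hmin hS' hS]

theorem G0.mk_moduleOfRep_of_isTriangular {ι α : Type} [Fintype ι] [LinearOrder α] {ℓ : ι → α}
    {χ : ι → A →ₐ[ℂ] ℂ} {ρ : A →ₐ[ℂ] Module.End ℂ (ι →₀ ℂ)}
    (hρ : ∀ a, IsTriangular ℓ (fun i => χ i a) (ρ a)) :
    G0.mk (moduleOfRep ρ inferInstance) =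
      ∑ i, G0.mk (moduleOfRep ((Algebra.lmul ℂ ℂ).comp (χ i)) inferInstance) := by
  rw [← G0.mk_restrictRep_supported hρ Finset.univ fun a => by simp]
  exact G0.mk_moduleOfRep_of_bijective _ _ (Submodule.subtype _)
    ⟨Subtype.val_injective, fun v => ⟨⟨v, by simp⟩, rfl⟩⟩ fun a v => rfl

end GrothendieckClass

section Characteristic

variable {B W : Type} [Group W] {M : CoxeterMatrix B} (cs : CoxeterSystem M W) {X : Set W}

theorem isTriangular_piOp (s : B) :
    IsTriangular (fun x : X => cs.length (x : W))
      (fun x => ZeroHecke.char (Des cs (x : W)) (ZeroHecke.gen M s)) (piOp cs X s) := by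
  refine IsTriangular.of_single fun x y hxy => ?_
  rw [single_one_eq_basisVec, ZeroHecke.char, ZeroHecke.lift_gen]
  by_cases hy : cs.IsLeftDescent (y : W) s
  · rw [piOp_basisVec_of_isLeftDescent cs hy, if_pos (show s ∈ Des cs (y : W) from hy),
      ← single_one_eq_basisVec, Finsupp.single_neg]
  · rw [piOp_basisVec_of_not_isLeftDescent cs hy, if_pos y.2,
      if_neg (show s ∉ Des cs (y : W) from hy), Finsupp.single_zero, Finsupp.zero_apply]
    by_cases hsy : cs.simple s * (y : W) ∈ X
    · rw [← single_one_eq_basisVec ⟨_, hsy⟩, Finsupp.single_eq_of_ne]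
      rintro rfl
      exact hxy.not_gt (by simp [cs.not_isLeftDescent_iff.1 hy])
    · rw [basisVec_of_notMem hsy, Finsupp.zero_apply]

theorem isTriangular_ascentRep (hX : AscentCompatible cs X) (a : ZeroHecke M) :
    IsTriangular (fun x : X => cs.length (x : W)) (fun x => ZeroHecke.char (Des cs (x : W)) a)
      (ascentRep cs hX a) := by
  induction a using ZeroHecke.induction with
  | hc c => simpa using IsTriangular.algebraMap c
  | hg s => simpa only [ascentRep_gen] using isTriangular_piOp cs s
  | ha a b iha ihb => simpa only [map_add] using! iha.add ihb
  | hm a b iha ihb => simpa only [map_mul] using! iha.mul ihb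

end Characteristic
end TypeB

theorem mainTheorem3_general {B W : Type} [Group W] {M : CoxeterMatrix B} (cs : CoxeterSystem M W)
    (X : Set W) [Finite X] (hX : TypeB.AscentCompatible cs X) :
    ∃ ρ : TypeB.ZeroHecke M →ₐ[ℂ] Module.End ℂ (X →₀ ℂ),
      (∀ s, ρ (TypeB.ZeroHecke.gen M s) = TypeB.piOp cs X s) ∧
      TypeB.G0.mk (TypeB.moduleOfRep ρ inferInstance) =
        ∑ᶠ x ∈ X, TypeB.G0.mk
          (TypeB.moduleOfRep (TypeB.ZeroHecke.simpleRep (TypeB.Des cs x)) inferInstance) := by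
  have := Fintype.ofFinite X
  refine ⟨TypeB.ascentRep cs hX, TypeB.ascentRep_gen cs hX, ?_⟩
  rw [TypeB.G0.mk_moduleOfRep_of_isTriangular (TypeB.isTriangular_ascentRep cs hX),
    ← finsum_set_coe_eq_finsum_mem, finsum_eq_sum_of_fintype]
  rfl

theorem mainTheorem3 (n : ℕ) {W : Type} [Group W]
    (cs : CoxeterSystem (TypeB.matrixB n) W) (X : Set W) (hX : TypeB.AscentCompatible cs X) :
    ∃ ρ : TypeB.HeckeB n →ₐ[ℂ] Module.End ℂ (X →₀ ℂ),
      (∀ s : Fin n, ρ (TypeB.ZeroHecke.gen (TypeB.matrixB n) s) = TypeB.piOp cs X s) ∧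
      TypeB.chB n (TypeB.G0.mk (TypeB.moduleOfRep ρ (TypeB.finite_free cs X))) =
        ∑ᶠ x ∈ X, TypeB.fundamentalB n (TypeB.Des cs x) := by
  have := TypeB.finite_group cs
  obtain ⟨ρ, hρ, hclass⟩ := mainTheorem3_general cs X hX
  refine ⟨ρ, hρ, ?_⟩
  rw [hclass, AddMonoidHom.map_finsum_mem _ _ X.toFinite]
  exact finsum_mem_congr rfl fun x _ => TypeB.chB_simpleClass _
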